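/- Let $\mathcal A$ be an abelian category. A bifiltered object $(X,W,F)$ is an object $X$ of $\mathcal A$ with a finite increasing filtration $W_\bullet X$ and a finite decreasing filtration $F^\bullet X$ by subobjects ($W_p=0$ and $F^{-p}=0$ for $p\ll 0$, $W_p=X$ and $F^{-p}=X$ for $p\gg0$); morphisms are the morphisms of $\mathcal A$ compatible with both filtrations. Write $W_pF^q:=W_p\cap F^q$, $Gr_p^WGr_F^q:=W_pF^q/(W_{p-1}F^q+W_pF^{q+1})$, $\mathbf F^2\mathcal A$ for the category of bifiltered objects, and $\mathbf C^+(\mathbf F^2\mathcal A)$ for the category of bounded below cochain complexes in $\mathbf F^2\mathcal A$. Let $r\ge 0$ be an integer. - The dual décalage of $(K,W,F)\in\mathbf C^+(\mathbf F^2\mathcal A)$ is $\mathrm{Dec}^*_W(K,W,F)=(K,\mathrm{Dec}^*W,F)$ with $(\mathrm{Dec}^*W)_pK^n=d(W_{p-n+1}K^{n-1})+W_{p-n}K^n$; it is a functor which is the identity on underlying morphisms. Let $\mathcal E_{0,0}$ be the class of morphisms $f$ such that $H^*(Gr_p^WGr_F^qf)$ is an isomorphism for all $p,q\in\mathbb Z$,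 and let $\mathcal E_{r+1,0}:=(\mathrm{Dec}_W^*)^{-1}(\mathcal E_{r,0})$. Morphisms in $\mathcal E_{r,0}$ are called $E_{r,0}$-quasi-isomorphisms. Put $\mathbf D^+_{r,0}(\mathbf F^2\mathcal A):=\mathbf C^+(\mathbf F^2\mathcal A)[\mathcal E_{r,0}^{-1}]$. - An $(r,0)$-homotopy from $f$ to $g$, where $f,g:K\to L$, is a family $h^n:K^{n+1}\to L^n$ of morphisms of $\mathcal A$ with $h(W_pK^{n+1})\subseteq W_{p+r}L^n$, $h(F^qK^{n+1})\subseteq F^qL^n$ and $dh+hd=g-f$. Let $\mathcal S_{r,0}$ be the class of $(r,0)$-homotopy equivalences, i.e. morphisms $f$ admitting $g$ with $fg$ and $gf$ $(r,0)$-homotopic to the identities. - $(I,W,F)\in\mathbf C^+(\mathbf F^2\mathcal A)$ is $(r,0)$-injective if for all $p,q\in\mathbb Z$: $d(W_pF^qI)\subseteq W_{p-r}F^qI$, and $Gr_p^WGr_F^qI$ is a complex of injective objects of $\mathcal A$. Let $\mathbf C_{r,0}^+(\mathbf F^2\mathrm{Inj}\,\mathcal A)$ be the full subcategory of these complexes,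 and $\mathbf K_{r,0}^+(\mathbf F^2\mathrm{Inj}\,\mathcal A)$ its quotient by $(r,0)$-homotopy. Let $\mathcal C$ be a category with two classes of morphisms $\mathcal S,\mathcal W$, the morphisms of $\mathcal S$ being invertible in $\mathcal C[\mathcal W^{-1}]$. An object $M$ is fibrant if for every $w:X\to Y$ in $\mathcal W$ the map $w^*:\mathcal C[\mathcal S^{-1}](Y,M)\to\mathcal C[\mathcal S^{-1}](X,M)$ is bijective. A right model of $X$ is a morphism $X\to M$ of $\mathcal C[\mathcal S^{-1}]$ that becomes an isomorphism in $\mathcal C[\mathcal W^{-1}]$. The triple $(\mathcal C,\mathcal S,\mathcal W)$ is a right Cartan–Eilenberg category with fibrant models in a full subcategory $\mathcal M$ if all objects of $\mathcal M$ are fibrant and every object of $\mathcal C$ has a right model in $\mathcal M$. **Theorem.** Let $\mathcal A$ be an abelian category with enough injectives and let $r\ge0$. Then $\mathcal S_{r,0}\subseteq\mathcal E_{r,0}$, and $(\mathbf C^+(\mathbf F^2\mathcal A),\mathcal S_{r,0},\mathcal E_{r,0})$ is a right Cartan–Eilenberg category with fibrant models in $\mathbf C_{r,0}^+(\mathbf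 F^2\mathrm{Inj}\,\mathcal A)$. The inclusion induces an equivalence of categories $$\mathbf K_{r,0}^+(\mathbf F^2\mathrm{Inj}\,\mathcal A)\stackrel{\sim}{\longrightarrow}\mathbf D_{r,0}^+(\mathbf F^2\mathcal A).$$ -/

import Mathlib

open CategoryTheory CategoryTheory.Limits

universe v u

/-! ## Right Cartan–Eilenberg categories -/

namespace CartanEilenberg

variable {C : Type u} [Category.{v} C]

/-- `M` is fibrant with respect to the strong equivalences `S` and the weak equivalences `W`:
every `w : X ⟶ Y` in `W` induces a bijection `w^* : C[S⁻¹](Y, M) → C[S⁻¹](X, M)`. -/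
def IsFibrant (S W : MorphismProperty C) (M : C) : Prop :=
  ∀ ⦃X Y : C⦄ (w : X ⟶ Y), W w →
    Function.Bijective (fun g : S.Q.obj Y ⟶ S.Q.obj M => S.Q.map w ≫ g)

/-- The canonical functor `C[S⁻¹] ⥤ C[W⁻¹]`, defined when the morphisms of `S` become
invertible in `C[W⁻¹]`. -/
noncomputable abbrev comparison (S W : MorphismProperty C) (h : S.IsInvertedBy W.Q) :
    S.Localization ⥤ W.Localization :=
  Localization.Construction.lift W.Q h

/-- `M` is a right model of `X`: there is a morphism `X ⟶ M` of `C[S⁻¹]` which becomes an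
isomorphism in `C[W⁻¹]`. -/
def IsRightModel (S W : MorphismProperty C) (h : S.IsInvertedBy W.Q) (X M : C) : Prop :=
  ∃ ε : S.Q.obj X ⟶ S.Q.obj M, IsIso ((comparison S W h).map ε)

/-- `(C, S, W)` is a right Cartan–Eilenberg category with fibrant models in the full subcategory
of objects satisfying `P`: strong equivalences are inverted in `C[W⁻¹]`, the objects satisfying `P`
are fibrant, and every object of `C` has a right model satisfying `P`
(in particular every object has a fibrant right model). -/
structure IsRightCartanEilenberg (S W : MorphismProperty C) (P : ObjectProperty C) : Prop where
  inverts : S.IsInvertedBy W.Q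
  fibrant : ∀ M : C, P M → IsFibrant S W M
  exists_model : ∀ X : C, ∃ M : C, P M ∧ IsRightModel S W inverts X M

end CartanEilenberg

namespace CategoryTheory.Subobject

variable {A : Type u} [Category.{v} A] [Abelian A]

/-- The morphism `f : X ⟶ Y` sends the subobject `S` of `X` into the subobject `T` of `Y`. -/
def MapsInto {X Y : A} (f : X ⟶ Y) (S : Subobject X) (T : Subobject Y) : Prop :=
  T.Factors (S.arrow ≫ f)

/-- The image `f(S)`, a subobject of `Y`, of the subobject `S` of `X` under `f : X ⟶ Y`. -/
noncomputable def imageOf {X Y : A} (f : X ⟶ Y) (S : Subobject X) : Subobject Y :=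
  imageSubobject (S.arrow ≫ f)

section lemmas

variable {X Y Z : A}

/-- The restriction `S ⟶ T` of a morphism `f : X ⟶ Y` which sends `S` into `T`. -/
noncomputable def MapsInto.map {f : X ⟶ Y} {S : Subobject X} {T : Subobject Y}
    (h : MapsInto f S T) : (S : A) ⟶ (T : A) :=
  Subobject.factorThru T (S.arrow ≫ f) h

@[simp]
lemma MapsInto.map_arrow {f : X ⟶ Y} {S : Subobject X} {T : Subobject Y}
    (h : MapsInto f S T) : h.map ≫ T.arrow = S.arrow ≫ f :=
  Subobject.factorThru_arrow _ _ _

@[simp]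
lemma MapsInto.map_arrow_assoc {f : X ⟶ Y} {S : Subobject X} {T : Subobject Y}
    (h : MapsInto f S T) (g : Y ⟶ Z) : h.map ≫ T.arrow ≫ g = S.arrow ≫ f ≫ g := by
  rw [← Category.assoc, h.map_arrow, Category.assoc]

lemma MapsInto.map_eq {f : X ⟶ Y} {S : Subobject X} {T : Subobject Y}
    (φ : (S : A) ⟶ (T : A)) (h : MapsInto f S T) (hφ : φ ≫ T.arrow = S.arrow ≫ f) : h.map = φ := by
  rw [← cancel_mono T.arrow, hφ, h.map_arrow]

lemma mapsInto_iff_le_pullback {f : X ⟶ Y} {S : Subobject X} {T : Subobject Y} :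
    MapsInto f S T ↔ S ≤ (pullback f).obj T := by
  constructor
  · intro h
    refine Subobject.le_of_comm
      ((isPullback f T).lift h.map S.arrow h.map_arrow) ?_
    exact (isPullback f T).lift_snd _ _ _
  · intro h
    rw [MapsInto, ← Subobject.ofLE_arrow h, Category.assoc, ← (isPullback f T).w,
      ← Category.assoc]
    exact factors_comp_arrow _

lemma mapsInto_iff_imageOf_le {f : X ⟶ Y} {S : Subobject X} {T : Subobject Y} :
    MapsInto f S T ↔ imageOf f S ≤ T := by
  constructor
  · intro h
    exact imageSubobject_le _ h.map h.map_arrow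
  · intro h
    have := imageSubobject_factors_comp_self (f := S.arrow ≫ f) (𝟙 _)
    rw [Category.id_comp] at this
    exact factors_of_le _ h this

lemma MapsInto.comp {f : X ⟶ Y} {g : Y ⟶ Z} {S : Subobject X} {T : Subobject Y} {U : Subobject Z}
    (hf : MapsInto f S T) (hg : MapsInto g T U) : MapsInto (f ≫ g) S U := by
  rw [MapsInto, ← Category.assoc, ← T.factorThru_arrow _ hf, Category.assoc]
  exact factors_of_factors_right _ hg

lemma MapsInto.mono {f : X ⟶ Y} {S S' : Subobject X} {T T' : Subobject Y}
    (h : MapsInto f S T) (hS : S' ≤ S) (hT : T ≤ T') : MapsInto f S' T' := by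
  rw [mapsInto_iff_le_pullback] at *
  exact (hS.trans h).trans ((pullback f).monotone hT)

lemma mapsInto_imageOf_iff {f : X ⟶ Y} {g : Y ⟶ Z} {S : Subobject X} {U : Subobject Z} :
    MapsInto g (imageOf f S) U ↔ MapsInto (f ≫ g) S U := by
  rw [mapsInto_iff_le_pullback, ← mapsInto_iff_imageOf_le, mapsInto_iff_le_pullback,
    ← pullback_comp, ← mapsInto_iff_le_pullback]

lemma MapsInto.sup {f : X ⟶ Y} {S S' : Subobject X} {T : Subobject Y}
    (h : MapsInto f S T) (h' : MapsInto f S' T) : MapsInto f (S ⊔ S') T := by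
  rw [mapsInto_iff_le_pullback] at *
  exact sup_le h h'

lemma MapsInto.inf {f : X ⟶ Y} {S S' : Subobject X} {T T' : Subobject Y}
    (h : MapsInto f S T) (h' : MapsInto f S' T') : MapsInto f (S ⊓ S') (T ⊓ T') :=
  (inf_factors _).2 ⟨h.mono _root_.inf_le_left le_rfl, h'.mono _root_.inf_le_right le_rfl⟩

lemma mapsInto_id {S T : Subobject X} (h : S ≤ T) : MapsInto (𝟙 X) S T := by
  rw [MapsInto, Category.comp_id]
  exact factors_of_le _ h (factors_self S)

lemma mapsInto_imageOf (f : X ⟶ Y) (S : Subobject X) : MapsInto f S (imageOf f S) :=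
  mapsInto_iff_imageOf_le.2 le_rfl

lemma mapsInto_zero (S : Subobject X) (T : Subobject Y) : MapsInto (0 : X ⟶ Y) S T := by
  rw [MapsInto, comp_zero]
  exact factors_zero

lemma MapsInto.add {f g : X ⟶ Y} {S : Subobject X} {T : Subobject Y}
    (hf : MapsInto f S T) (hg : MapsInto g S T) : MapsInto (f + g) S T := by
  rw [MapsInto, Preadditive.comp_add]
  exact factors_add _ _ hf hg

lemma MapsInto.neg {f : X ⟶ Y} {S : Subobject X} {T : Subobject Y}
    (hf : MapsInto f S T) : MapsInto (-f) S T := by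
  rw [MapsInto, Preadditive.comp_neg, ← T.factorThru_arrow _ hf, ← Preadditive.neg_comp]
  exact factors_comp_arrow _

lemma imageOf_bot (f : X ⟶ Y) : imageOf f ⊥ = ⊥ := by
  refine le_bot_iff.1 (mapsInto_iff_imageOf_le.1 ?_)
  rw [mapsInto_iff_le_pullback]
  exact bot_le

lemma imageOf_mono (f : X ⟶ Y) {S S' : Subobject X} (h : S ≤ S') : imageOf f S ≤ imageOf f S' :=
  mapsInto_iff_imageOf_le.1 ((mapsInto_imageOf f S').mono h le_rfl)

end lemmas

end CategoryTheory.Subobject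

open CategoryTheory.Subobject

/-! ## Bifiltered objects -/

/-- An object `X` of `A` with a finite increasing filtration `W` and a finite decreasing
filtration `F` by subobjects. -/
structure BifilteredObject (A : Type u) [Category.{v} A] [Abelian A] where
  X : A
  W : ℤ → Subobject X
  F : ℤ → Subobject X
  W_mono : Monotone W
  F_anti : Antitone F
  W_bot : ∃ p, W p = ⊥
  W_top : ∃ p, W p = ⊤
  F_bot : ∃ q, F q = ⊥
  F_top : ∃ q, F q = ⊤

namespace BifilteredObject

variable {A : Type u} [Category.{v} A] [Abelian A]

/-- Morphisms `f : X ⟶ Y` of `A` with `f(W_p X) ⊆ W_p Y` and `f(F^q X) ⊆ F^q Y`. -/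
@[ext]
structure Hom (X Y : BifilteredObject A) where
  val : X.X ⟶ Y.X
  mapsInto_W : ∀ p, MapsInto val (X.W p) (Y.W p)
  mapsInto_F : ∀ q, MapsInto val (X.F q) (Y.F q)

/-- The category `F²A` of bifiltered objects of `A`. -/
instance : Category.{v} (BifilteredObject A) where
  Hom X Y := Hom X Y
  id X := ⟨𝟙 X.X, fun _ => mapsInto_id le_rfl, fun _ => mapsInto_id le_rfl⟩
  comp f g := ⟨f.val ≫ g.val, fun p => (f.mapsInto_W p).comp (g.mapsInto_W p),
    fun q => (f.mapsInto_F q).comp (g.mapsInto_F q)⟩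
  id_comp f := Hom.ext (Category.id_comp f.val)
  comp_id f := Hom.ext (Category.comp_id f.val)
  assoc f g h := Hom.ext (Category.assoc f.val g.val h.val)

@[simp] lemma id_val (X : BifilteredObject A) : (𝟙 X : X ⟶ X).val = 𝟙 X.X := rfl

@[simp] lemma comp_val {X Y Z : BifilteredObject A} (f : X ⟶ Y) (g : Y ⟶ Z) :
    (f ≫ g).val = f.val ≫ g.val := rfl

@[ext] lemma hom_ext {X Y : BifilteredObject A} {f g : X ⟶ Y} (h : f.val = g.val) :
    f = g := Hom.ext h

section

variable {X Y : BifilteredObject A}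

instance : Zero (X ⟶ Y) := ⟨⟨0, fun _ => mapsInto_zero _ _, fun _ => mapsInto_zero _ _⟩⟩

instance : Add (X ⟶ Y) := ⟨fun f g => ⟨f.val + g.val,
  fun p => (f.mapsInto_W p).add (g.mapsInto_W p), fun q => (f.mapsInto_F q).add (g.mapsInto_F q)⟩⟩

instance : Neg (X ⟶ Y) := ⟨fun f => ⟨-f.val,
  fun p => (f.mapsInto_W p).neg, fun q => (f.mapsInto_F q).neg⟩⟩

@[simp] lemma zero_val : (0 : X ⟶ Y).val = 0 := rfl

@[simp] lemma add_val (f g : X ⟶ Y) : (f + g).val = f.val + g.val := rfl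

@[simp] lemma neg_val (f : X ⟶ Y) : (-f).val = -f.val := rfl

instance : AddCommGroup (X ⟶ Y) where
  add_assoc f g h := hom_ext (add_assoc f.val g.val h.val)
  zero_add f := hom_ext (zero_add f.val)
  add_zero f := hom_ext (add_zero f.val)
  add_comm f g := hom_ext (add_comm f.val g.val)
  neg_add_cancel f := hom_ext (neg_add_cancel f.val)
  nsmul := nsmulRec
  zsmul := zsmulRec

@[simp] lemma sub_val (f g : X ⟶ Y) : (f - g).val = f.val - g.val :=
  (sub_eq_add_neg f.val g.val).symm

end

instance : Preadditive (BifilteredObject A) where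
  add_comp _ _ _ f f' g := hom_ext (Preadditive.add_comp _ _ _ f.val f'.val g.val)
  comp_add _ _ _ f g g' := hom_ext (Preadditive.comp_add _ _ _ f.val g.val g'.val)

/-- The subobject `W_p F^q := W_p ∩ F^q`. -/
noncomputable def WF (X : BifilteredObject A) (p q : ℤ) : Subobject X.X := X.W p ⊓ X.F q

/-- The subobject `W_{p-1} F^q + W_p F^{q+1}` of `W_p F^q`. -/
noncomputable def WFlow (X : BifilteredObject A) (p q : ℤ) : Subobject X.X :=
  X.WF (p - 1) q ⊔ X.WF p (q + 1)

lemma WFlow_le (X : BifilteredObject A) (p q : ℤ) : X.WFlow p q ≤ X.WF p q :=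
  sup_le (inf_le_inf_right _ (X.W_mono (by lia))) (inf_le_inf_left _ (X.F_anti (by lia)))

lemma Hom.mapsInto_WF {X Y : BifilteredObject A} (f : X ⟶ Y) (p q : ℤ) :
    MapsInto f.val (X.WF p q) (Y.WF p q) :=
  (f.mapsInto_W p).inf (f.mapsInto_F q)

lemma Hom.mapsInto_WFlow {X Y : BifilteredObject A} (f : X ⟶ Y) (p q : ℤ) :
    MapsInto f.val (X.WFlow p q) (Y.WFlow p q) :=
  ((Hom.mapsInto_WF f _ _).mono le_rfl le_sup_left).sup
    ((Hom.mapsInto_WF f _ _).mono le_rfl le_sup_right)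

/-- The bigraded piece
`Gr_p^W Gr_F^q X = (W_p ∩ F^q) / (W_{p-1} ∩ F^q + W_p ∩ F^{q+1})`, as a functor `F²A ⥤ A`.
It is `Gr_p^W` of `Gr_F^q X` with the filtration induced by `W`. -/
noncomputable def gr (p q : ℤ) : BifilteredObject A ⥤ A where
  obj X := cokernel (Subobject.ofLE _ _ (X.WFlow_le p q))
  map {X Y} f := cokernel.map _ _
    (MapsInto.map (Hom.mapsInto_WFlow f p q)) (MapsInto.map (Hom.mapsInto_WF f p q))
    (by ext; simp)
  map_id X := by
    apply coequalizer.hom_ext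
    rw [cokernel.π_desc, Category.comp_id, MapsInto.map_eq (𝟙 _) _ (by simp), Category.id_comp]
  map_comp {X Y Z} f g := by
    apply coequalizer.hom_ext
    rw [cokernel.π_desc, cokernel.π_desc_assoc, Category.assoc, cokernel.π_desc,
      MapsInto.map_eq (MapsInto.map (Hom.mapsInto_WF f p q) ≫ MapsInto.map (Hom.mapsInto_WF g p q))
        _ (by simp), Category.assoc]

instance (p q : ℤ) : (gr p q : BifilteredObject A ⥤ A).PreservesZeroMorphisms where
  map_zero X Y := by
    apply coequalizer.hom_ext
    refine (cokernel.π_desc _ _ _).trans ?_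
    rw [MapsInto.map_eq 0 (Hom.mapsInto_WF (0 : X ⟶ Y) p q) (by simp), zero_comp]
    exact comp_zero.symm

/-- The bifiltered object `(X, W(r), F)`, where `W(r)_p := W_{p-r}`. -/
def shiftWObj (r : ℕ) (X : BifilteredObject A) : BifilteredObject A where
  X := X.X
  W p := X.W (p - r)
  F := X.F
  W_mono _ _ h := X.W_mono (sub_le_sub_right h _)
  F_anti := X.F_anti
  W_bot := by
    obtain ⟨p, hp⟩ := X.W_bot
    exact ⟨p + r, by rw [add_sub_cancel_right, hp]⟩
  W_top := by
    obtain ⟨p, hp⟩ := X.W_top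
    exact ⟨p + r, by rw [add_sub_cancel_right, hp]⟩
  F_bot := X.F_bot
  F_top := X.F_top

/-- The automorphism of `F²A` sending `(X, W, F)` to `(X, W(r), F)`, the identity on morphisms. -/
def shiftW (r : ℕ) : BifilteredObject A ⥤ BifilteredObject A where
  obj X := shiftWObj r X
  map f :=
    { val := f.val
      mapsInto_W := fun p => f.mapsInto_W (p - r)
      mapsInto_F := f.mapsInto_F }

/-- The natural transformation `(X, W(r), F) ⟶ (X, W, F)` given by the identity of `X`. -/
def shiftWCounit (r : ℕ) : shiftW r ⟶ 𝟭 (BifilteredObject A) where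
  app X :=
    { val := 𝟙 X.X
      mapsInto_W := fun p => mapsInto_id (X.W_mono (sub_le_self p (Int.natCast_nonneg r)))
      mapsInto_F := fun _ => mapsInto_id le_rfl }
  naturality X Y f :=
    hom_ext ((Category.comp_id f.val).trans (Category.id_comp f.val).symm)

end BifilteredObject

/-! ## Bifiltered complexes -/

/-- The category `C⁺(F²A)` of bounded below complexes of bifiltered objects. -/
abbrev BifilteredComplex (A : Type u) [Category.{v} A] [Abelian A] :=
  CochainComplex.Plus (BifilteredObject A)

namespace BifilteredComplex

open BifilteredObject

variable {A : Type u} [Category.{v} A] [Abelian A]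

/-- The degree `n` bifiltered object of a bifiltered complex. -/
abbrev deg (K : BifilteredComplex A) (n : ℤ) : BifilteredObject A := K.obj.X n

/-- The differential `K^i ⟶ K^j` (zero unless `i + 1 = j`). -/
abbrev diff (K : BifilteredComplex A) (i j : ℤ) : K.deg i ⟶ K.deg j := K.obj.d i j

/-- The degree `n` component of a morphism of bifiltered complexes. -/
abbrev comp {K L : BifilteredComplex A} (f : K ⟶ L) (n : ℤ) : K.deg n ⟶ L.deg n := f.hom.f n

/-! ### Dual décalage with respect to `W` -/

/-- `(Dec* W)_p K^n = d(W_{p-n+1} K^{n-1}) + W_{p-n} K^n`. -/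
noncomputable def decStarW (K : CochainComplex (BifilteredObject A) ℤ) (n p : ℤ) :
    Subobject (K.X n).X :=
  imageOf (K.d (n - 1) n).val ((K.X (n - 1)).W (p - n + 1)) ⊔ (K.X n).W (p - n)

/-- The degree `n` component of the dual décalage `(K, Dec* W, F)`. -/
noncomputable def decStarX (K : CochainComplex (BifilteredObject A) ℤ) (n : ℤ) :
    BifilteredObject A where
  X := (K.X n).X
  W := decStarW K n
  F := (K.X n).F
  W_mono _ _ h := sup_le_sup (imageOf_mono _ ((K.X (n - 1)).W_mono (by lia)))
    ((K.X n).W_mono (by lia))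
  F_anti := (K.X n).F_anti
  W_bot := by
    obtain ⟨a, ha⟩ := (K.X (n - 1)).W_bot
    obtain ⟨b, hb⟩ := (K.X n).W_bot
    refine ⟨min (a + n - 1) (b + n), ?_⟩
    have h1 : (K.X (n - 1)).W (min (a + n - 1) (b + n) - n + 1) = ⊥ :=
      le_bot_iff.1 (ha ▸ (K.X (n - 1)).W_mono (by lia))
    have h2 : (K.X n).W (min (a + n - 1) (b + n) - n) = ⊥ :=
      le_bot_iff.1 (hb ▸ (K.X n).W_mono (by lia))
    rw [decStarW, h1, h2, imageOf_bot, bot_sup_eq]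
  W_top := by
    obtain ⟨b, hb⟩ := (K.X n).W_top
    refine ⟨b + n, top_le_iff.1 (le_sup_of_le_right ?_)⟩
    rw [add_sub_cancel_right, hb]
  F_bot := (K.X n).F_bot
  F_top := (K.X n).F_top

lemma decStar_d_mapsInto (K : CochainComplex (BifilteredObject A) ℤ) (i j p : ℤ) :
    MapsInto (K.d i j).val (decStarW K i p) (decStarW K j p) := by
  by_cases hij : i + 1 = j
  · obtain rfl : i = j - 1 := by lia
    refine MapsInto.sup ?_ ?_
    · rw [mapsInto_imageOf_iff, ← comp_val, K.d_comp_d, zero_val]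
      exact mapsInto_zero _ _
    · exact (mapsInto_imageOf _ _).mono ((K.X (j - 1)).W_mono (by lia)) le_sup_left
  · rw [K.shape i j hij, zero_val]
    exact mapsInto_zero _ _

lemma decStar_f_mapsInto {K L : CochainComplex (BifilteredObject A) ℤ} (f : K ⟶ L) (n p : ℤ) :
    MapsInto (f.f n).val (decStarW K n p) (decStarW L n p) := by
  refine MapsInto.sup ?_ (((f.f n).mapsInto_W _).mono le_rfl le_sup_right)
  rw [mapsInto_imageOf_iff, ← comp_val, ← f.comm, comp_val]
  exact ((f.f (n - 1)).mapsInto_W _).comp ((mapsInto_imageOf _ _).mono le_rfl le_sup_left)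

/-- The dual décalage `(K, Dec* W, F)` of a complex of bifiltered objects `(K, W, F)`. It leaves the
underlying complex and the filtration `F` unchanged. -/
noncomputable def decStarObj (K : CochainComplex (BifilteredObject A) ℤ) :
    CochainComplex (BifilteredObject A) ℤ where
  X := decStarX K
  d i j :=
    { val := (K.d i j).val
      mapsInto_W := decStar_d_mapsInto K i j
      mapsInto_F := (K.d i j).mapsInto_F }
  shape i j hij := by
    have h : (K.d i j).val = 0 := congrArg Hom.val (K.shape i j hij)
    exact hom_ext h
  d_comp_d' i j k _ _ := by
    have h : (K.d i j).val ≫ (K.d j k).val = 0 := congrArg Hom.val (K.d_comp_d i j k)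
    exact hom_ext h

/-- The dual décalage as a functor on all complexes of bifiltered objects; it is the identity on
underlying morphisms. -/
noncomputable def decStarAux :
    CochainComplex (BifilteredObject A) ℤ ⥤ CochainComplex (BifilteredObject A) ℤ where
  obj K := decStarObj K
  map {K L} f :=
    { f := fun n =>
        { val := (f.f n).val
          mapsInto_W := decStar_f_mapsInto f n
          mapsInto_F := (f.f n).mapsInto_F }
      comm' := fun i j _ => by
        have h : (f.f i).val ≫ (L.d i j).val = (K.d i j).val ≫ (f.f j).val :=
          congrArg Hom.val (f.comm i j)
        exact hom_ext h }

/-- The dual décalage functor `Dec*_W : C⁺(F²A) ⥤ C⁺(F²A)`. -/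
noncomputable def decStar : BifilteredComplex A ⥤ BifilteredComplex A :=
  ObjectProperty.lift _ (CochainComplex.Plus.ι _ ⋙ decStarAux) (by
    rintro ⟨K, n, hn⟩
    refine ⟨n, (CochainComplex.isStrictlyGE_iff _ n).2 fun i hi => ?_⟩
    rw [IsZero.iff_id_eq_zero]
    have h := (IsZero.iff_id_eq_zero _).1 (CochainComplex.isZero_of_isStrictlyGE K n i hi)
    have h' : 𝟙 (K.X i).X = 0 := congrArg Hom.val h
    exact hom_ext h')

/-! ### Weak equivalences -/

/-- The class `E_{0,0}`: morphisms `f` such that `H(Gr_p^W Gr_F^q f)` is an isomorphism for all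
`p` and `q`. -/
def quasiIsoZero : MorphismProperty (BifilteredComplex A) := fun _ _ f =>
  ∀ p q : ℤ, QuasiIso (((gr p q).mapHomologicalComplex (ComplexShape.up ℤ)).map f.hom)

/-- The class `E_{r,0}` of `E_{r,0}`-quasi-isomorphisms: `E_{r+1,0} = (Dec*_W)⁻¹(E_{r,0})`, where
`Dec*_W` is the dual décalage. -/
def quasiIso : ℕ → MorphismProperty (BifilteredComplex A)
  | 0 => quasiIsoZero
  | r + 1 => (quasiIso r).inverseImage decStar

/-! ### Homotopies -/

/-- An `(r,0)`-homotopy from `f` to `g`: morphisms of bifiltered objects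
`h^n : (K^{n+1}, W(r), F) ⟶ (L^n, W, F)` with `d h + h d = g - f`, i.e. morphisms
`K^{n+1} ⟶ L^n` of `A` sending `W_p` to `W_{p+r}` and `F^q` to `F^q`. -/
structure RHomotopy (r : ℕ) {K L : BifilteredComplex A} (f g : K ⟶ L) where
  h : ∀ n : ℤ, (shiftW r).obj (K.deg (n + 1)) ⟶ L.deg n
  comm : ∀ n : ℤ,
    h n ≫ L.diff n (n + 1) + (shiftW r).map (K.diff (n + 1) (n + 1 + 1)) ≫ h (n + 1) =
      (shiftWCounit r).app (K.deg (n + 1)) ≫ (comp g (n + 1) - comp f (n + 1))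

/-- The class `S_{r,0}` of `(r,0)`-homotopy equivalences. -/
def homotopyEquiv (r : ℕ) : MorphismProperty (BifilteredComplex A) := fun K L f =>
  ∃ g : L ⟶ K, Nonempty (RHomotopy r (f ≫ g) (𝟙 K)) ∧ Nonempty (RHomotopy r (g ≫ f) (𝟙 L))

/-! ### `(r,0)`-injective complexes -/

/-- `(r,0)`-injective complexes: `d(W_p F^q) ⊆ W_{p-r} F^q`, and `Gr_p^W Gr_F^q` is a complex of
injective objects, for all `p` and `q`. -/
def isInjective (r : ℕ) : ObjectProperty (BifilteredComplex A) := fun I =>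
  ∀ p q n : ℤ,
    MapsInto (I.diff n (n + 1)).val ((I.deg n).WF p q) ((I.deg (n + 1)).WF (p - r) q) ∧
    Injective ((gr p q).obj (I.deg n))

/-- The relation of `(r,0)`-homotopy on morphisms between `(r,0)`-injective complexes. -/
def injectiveHomotopyRel (A : Type u) [Category.{v} A] [Abelian A] (r : ℕ) :
    HomRel (isInjective (A := A) r).FullSubcategory :=
  fun _ _ f g => Nonempty (RHomotopy r f.hom g.hom)

/-- The category `K_{r,0}⁺(F² Inj A)` of `(r,0)`-injective complexes modulo `(r,0)`-homotopy.
(The homotopy relation is additive and stable under composition, so it is a congruence.) -/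
abbrev InjectiveHomotopyCategory (A : Type u) [Category.{v} A] [Abelian A] (r : ℕ) :=
  CategoryTheory.Quotient (injectiveHomotopyRel A r)

/-- The derived category `D_{r,0}⁺(F²A) = C⁺(F²A)[E_{r,0}⁻¹]`. -/
abbrev DerivedCat (A : Type u) [Category.{v} A] [Abelian A] (r : ℕ) :=
  (quasiIso (A := A) r).Localization

end BifilteredComplex

/-!
# Injective models for bifiltered complexes

The proof treats `r = 0` by relative homological algebra and reaches every `r` by décalage.

**Bifiltered objects.** `F²A` is additive but not abelian. It is studied through the right exact
functors `lowQuo p q : X ↦ X / (W_{p-1} + F^{q+1})`, which are left adjoint to the functors placing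
an object of `A` in bidegree `(p, q)` (`lowQuoAdjunction`). Subobjects form a modular lattice, so
each of these quotients is a finite iterated extension of bigraded pieces (`quo_induction`); hence
the bigraded pieces and the quotients `lowQuo p q` define the same acyclic complexes and the same
quasi-isomorphisms (`acyclic_gr_iff`, `quasiIso_gr_iff`). By the adjunction, an injective object of
`A` placed in one bidegree is injective relatively to the sequences that are exact after all
`lowQuo p q`. An object `I` with injective bigraded pieces splits as the direct sum of these pieces,
so it is relatively injective too (`hasExtension_of_injective_gr`), and there are enough such
objects (`exists_injective_envelope`).

**The case `r = 0`.** The usual arguments apply: a map from an acyclic complex to a bounded below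
complex of relatively injective objects is null-homotopic, so homotopy classes of maps to such
a complex are invariant under `E_{0,0}`-quasi-isomorphisms (`bijective_precomp_homotopyCategory`);
and a resolution is built degree by degree, keeping the mapping cone acyclic
(`exists_injective_resolution`).

**Décalage.** The functor `Dec*` has a right adjoint `decStarRight`, which is fully faithful:
it reindexes `W_p K^n` as `W_{p+n} K^n`. This right adjoint sends `(r,0)`-injective complexes to
`(r+1,0)`-injective ones, and `Dec*` goes the other way; the unit is an isomorphism at
`(r+1,0)`-injective complexes (`isInjective.isIso_decStarUnit`). Both functors are compatible with
homotopies, up to the shift of `r` by one (`rHomotopy_decStar_iff`, `rHomotopy_decStarRight`). So each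
of the following passes from `r` to `r + 1`: homotopy equivalences are weak equivalences
(`homotopyEquiv_le_quasiIso`); homotopic maps to an `(r,0)`-injective complex become equal after
inverting homotopy equivalences (`homotopyEquiv_Q_map_eq`); homotopy classes of maps to it are
invariant under weak equivalences (`isLocalSetoid_homotopySetoid`); every complex has a weak
equivalence to an `(r,0)`-injective one (`exists_isInjective_quasiIso`).

**Conclusion.** If an equivalence relation on maps to `M` is compatible with composition, invariant
under a class `W`, and identifies only maps that are equal in `C[W⁻¹]`, then morphisms to `M` in
`C[W⁻¹]` are equivalence classes of maps (`IsLocalSetoid.rel_of_Q_map_eq`,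
`IsLocalSetoid.Q_map_surjective`). For the homotopy equivalences this gives the Cartan–Eilenberg
structure; for the weak equivalences it gives full faithfulness of the functor to the derived
category.
-/

/-! ### Generalized elements of subobjects -/

namespace CategoryTheory.Subobject

variable {A : Type u} [Category.{v} A] [Abelian A] {X : A}

lemma factors_of_epi_comp {S : Subobject X} {T T' : A} (π : T' ⟶ T) [Epi π] {x : T ⟶ X}
    (h : S.Factors (π ≫ x)) : S.Factors x := by
  have : StrongEpi π := strongEpi_of_epi π
  have sq : CommSq (S.factorThru _ h) π S.arrow x := ⟨by simp⟩
  exact (factors_iff _ _).2 ⟨sq.lift, sq.fac_right⟩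

lemma factors_sup_iff {S S' : Subobject X} {T : A} (x : T ⟶ X) :
    (S ⊔ S').Factors x ↔ ∃ (T' : A) (π : T' ⟶ T) (_ : Epi π) (s : T' ⟶ (S : A))
      (s' : T' ⟶ (S' : A)), π ≫ x = s ≫ S.arrow + s' ≫ S'.arrow := by
  constructor
  · intro h
    have hle : S ⊔ S' ≤ imageSubobject (biprod.desc S.arrow S'.arrow) :=
      sup_le
        (le_of_comm (biprod.inl ≫ factorThruImageSubobject _) (by simp))
        (le_of_comm (biprod.inr ≫ factorThruImageSubobject _) (by simp))
    have h' := factors_of_le _ hle h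
    obtain ⟨T', π, hπ, y, hy⟩ := surjective_up_to_refinements_of_epi
      (factorThruImageSubobject (biprod.desc S.arrow S'.arrow)) (factorThru _ _ h')
    refine ⟨T', π, hπ, y ≫ biprod.fst, y ≫ biprod.snd, ?_⟩
    have := hy =≫ (imageSubobject (biprod.desc S.arrow S'.arrow)).arrow
    simp only [Category.assoc, factorThru_arrow, imageSubobject_arrow_comp] at this
    rw [this, ← Category.comp_id y, ← biprod.total]
    simp [-biprod.total]
  · rintro ⟨T', π, _, s, s', h⟩
    refine factors_of_epi_comp π ?_
    rw [h]
    exact factors_add _ _ (sup_factors_of_factors_left (factors_comp_arrow _))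
      (sup_factors_of_factors_right (factors_comp_arrow _))

/-- Subobjects of an object of an abelian category satisfy the modular law. -/
instance : IsModularLattice (Subobject X) where
  sup_inf_le_assoc_of_le {S} S' S'' h := by
    refine le_of_factors ?_
    obtain ⟨T, π, hπ, s, s', hs⟩ := (factors_sup_iff ((S ⊔ S') ⊓ S'').arrow).1
      (factors_of_le _ _root_.inf_le_left (factors_self _))
    have h3 : S''.Factors ((S ⊔ S') ⊓ S'').arrow :=
      factors_of_le _ _root_.inf_le_right (factors_self _)
    have h4 : (S' ⊓ S'').Factors (s' ≫ S'.arrow) := by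
      refine (inf_factors _).2 ⟨factors_comp_arrow _, ?_⟩
      refine factors_right_of_factors_add (s ≫ S.arrow) (s' ≫ S'.arrow) ?_
        (factors_of_le _ h (factors_comp_arrow _))
      rw [← hs]
      exact factors_of_factors_right _ h3
    exact (factors_sup_iff _).2 ⟨T, π, hπ, s, factorThru _ _ h4, by simpa using hs⟩

lemma comp_cokernel_π_eq_zero_iff {S T : Subobject X} (h : S ≤ T) {B : A} (x : B ⟶ (T : A)) :
    x ≫ cokernel.π (ofLE S T h) = 0 ↔ S.Factors (x ≫ T.arrow) := by
  refine (CokernelCofork.IsColimit.comp_π_eq_zero_iff_up_to_refinements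
    (cokernelIsCokernel (ofLE S T h)) x).trans ?_
  constructor
  · rintro ⟨B', π, hπ, s, hs⟩
    refine factors_of_epi_comp π ?_
    rw [← Category.assoc, hs, Category.assoc, ofLE_arrow]
    exact factors_comp_arrow _
  · intro hx
    exact ⟨B, 𝟙 _, inferInstance, factorThru _ _ hx, by
      rw [← cancel_mono T.arrow]; simp⟩

end CategoryTheory.Subobject

/-! ### Subquotients attached to natural subobjects of bifiltered objects -/

/-- A subobject of the underlying object of every bifiltered object, preserved by all morphisms. -/
structure NaturalSubobject (A : Type u) [Category.{v} A] [Abelian A] where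
  obj : ∀ X : BifilteredObject A, Subobject X.X
  mapsInto : ∀ {X Y : BifilteredObject A} (f : X ⟶ Y), MapsInto f.val (obj X) (obj Y)

namespace NaturalSubobject

variable {A : Type u} [Category.{v} A] [Abelian A]

instance : LE (NaturalSubobject A) := ⟨fun S T => ∀ X, S.obj X ≤ T.obj X⟩

lemma le_trans' {S T U : NaturalSubobject A} (h : S ≤ T) (h' : T ≤ U) : S ≤ U :=
  fun X => (h X).trans (h' X)

/-- The sum of two natural subobjects. -/
noncomputable instance : Max (NaturalSubobject A) :=
  ⟨fun S T => ⟨fun X => S.obj X ⊔ T.obj X, fun f =>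
    ((S.mapsInto f).mono le_rfl le_sup_left).sup ((T.mapsInto f).mono le_rfl le_sup_right)⟩⟩

/-- The subobject `W_{p-1} + F^{q+1}`, the kernel of the projection to the largest quotient
concentrated in weights `≥ p` and Hodge degrees `≤ q`. -/
noncomputable def low (p q : ℤ) : NaturalSubobject A where
  obj X := X.W (p - 1) ⊔ X.F (q + 1)
  mapsInto f := ((f.mapsInto_W _).mono le_rfl le_sup_left).sup
    ((f.mapsInto_F _).mono le_rfl le_sup_right)

/-- The subobject `W_p ∩ F^q`. -/
noncomputable def WF (p q : ℤ) : NaturalSubobject A where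
  obj X := X.WF p q
  mapsInto f := f.mapsInto_WF p q

/-- The subobject `W_{p-1} F^q + W_p F^{q+1}`. -/
noncomputable def WFlow (p q : ℤ) : NaturalSubobject A where
  obj X := X.WFlow p q
  mapsInto f := f.mapsInto_WFlow p q

/-- The whole object. -/
noncomputable instance : Top (NaturalSubobject A) :=
  ⟨⟨fun _ => ⊤, fun _ => mapsInto_iff_imageOf_le.2 le_top⟩⟩

variable {S T U S' T' : NaturalSubobject A}

/-- The subquotient functor `X ↦ T(X) / S(X)`. -/
noncomputable def quo (S T : NaturalSubobject A) (h : S ≤ T) : BifilteredObject A ⥤ A where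
  obj X := cokernel (Subobject.ofLE _ _ (h X))
  map {X Y} f := cokernel.map _ _ (S.mapsInto f).map (T.mapsInto f).map (by ext; simp)
  map_id X := by
    apply coequalizer.hom_ext
    rw [cokernel.π_desc, Category.comp_id, MapsInto.map_eq (𝟙 _) _ (by simp), Category.id_comp]
  map_comp {X Y Z} f g := by
    apply coequalizer.hom_ext
    rw [cokernel.π_desc, cokernel.π_desc_assoc, Category.assoc, cokernel.π_desc,
      MapsInto.map_eq ((T.mapsInto f).map ≫ (T.mapsInto g).map) _ (by simp), Category.assoc]

/-- The projection `T(X) ⟶ T(X) / S(X)`. -/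
noncomputable def quoπ (h : S ≤ T) (X : BifilteredObject A) :
    (T.obj X : A) ⟶ (quo S T h).obj X := cokernel.π _

instance (h : S ≤ T) (X : BifilteredObject A) : Epi (quoπ h X) :=
  inferInstanceAs (Epi (cokernel.π (Subobject.ofLE _ _ (h X))))

lemma quoπ_map (h : S ≤ T) {X Y : BifilteredObject A} (f : X ⟶ Y) :
    quoπ h X ≫ (quo S T h).map f = (T.mapsInto f).map ≫ quoπ h Y :=
  cokernel.π_desc _ _ _

lemma quoπ_map_assoc (h : S ≤ T) {X Y : BifilteredObject A} (f : X ⟶ Y) {Z : A}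
    (g : (quo S T h).obj Y ⟶ Z) :
    quoπ h X ≫ (quo S T h).map f ≫ g = (T.mapsInto f).map ≫ quoπ h Y ≫ g := by
  rw [← Category.assoc, quoπ_map, Category.assoc]

lemma comp_quoπ_eq_zero_iff (h : S ≤ T) {X : BifilteredObject A} {B : A}
    (x : B ⟶ (T.obj X : A)) : x ≫ quoπ h X = 0 ↔ (S.obj X).Factors (x ≫ (T.obj X).arrow) :=
  comp_cokernel_π_eq_zero_iff (h X) x

instance (h : S ≤ T) : (quo S T h).Additive where
  map_add {X Y f g} := by
    rw [← cancel_epi (quoπ h X), Preadditive.comp_add, quoπ_map, quoπ_map, quoπ_map,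
      ← Preadditive.add_comp, MapsInto.map_eq ((T.mapsInto f).map + (T.mapsInto g).map) _ (by simp)]

/-- The component at `X` of `quoMap`. -/
noncomputable def quoMapApp (h : S ≤ T) (h' : S' ≤ T') (hS : S ≤ S') (hT : T ≤ T')
    (X : BifilteredObject A) : (quo S T h).obj X ⟶ (quo S' T' h').obj X :=
  cokernel.map _ _ (Subobject.ofLE _ _ (hS X)) (Subobject.ofLE _ _ (hT X)) (by simp)

lemma quoπ_quoMapApp (h : S ≤ T) (h' : S' ≤ T') (hS : S ≤ S') (hT : T ≤ T')
    (X : BifilteredObject A) :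
    quoπ h X ≫ quoMapApp h h' hS hT X = Subobject.ofLE _ _ (hT X) ≫ quoπ h' X :=
  cokernel.π_desc _ _ _

lemma quoπ_quoMapApp_assoc (h : S ≤ T) (h' : S' ≤ T') (hS : S ≤ S') (hT : T ≤ T')
    (X : BifilteredObject A) {Z : A} (g : (quo S' T' h').obj X ⟶ Z) :
    quoπ h X ≫ quoMapApp h h' hS hT X ≫ g = Subobject.ofLE _ _ (hT X) ≫ quoπ h' X ≫ g := by
  rw [← Category.assoc, quoπ_quoMapApp, Category.assoc]

/-- The morphism of subquotients induced by inclusions. -/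
noncomputable def quoMap (h : S ≤ T) (h' : S' ≤ T') (hS : S ≤ S') (hT : T ≤ T') :
    quo S T h ⟶ quo S' T' h' where
  app X := quoMapApp h h' hS hT X
  naturality X Y f := by
    rw [← cancel_epi (quoπ h X), quoπ_map_assoc, quoπ_quoMapApp, quoπ_quoMapApp_assoc, quoπ_map,
      ← Category.assoc, ← Category.assoc]
    congr 1
    rw [← cancel_mono (T'.obj Y).arrow]
    simp

@[simp]
lemma quoπ_quoMap_app (h : S ≤ T) (h' : S' ≤ T') (hS : S ≤ S') (hT : T ≤ T')
    (X : BifilteredObject A) :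
    quoπ h X ≫ (quoMap h h' hS hT).app X = Subobject.ofLE _ _ (hT X) ≫ quoπ h' X :=
  quoπ_quoMapApp h h' hS hT X

@[simp]
lemma quoπ_quoMap_app_assoc (h : S ≤ T) (h' : S' ≤ T') (hS : S ≤ S') (hT : T ≤ T')
    (X : BifilteredObject A) {Z : A} (g : (quo S' T' h').obj X ⟶ Z) :
    quoπ h X ≫ (quoMap h h' hS hT).app X ≫ g = Subobject.ofLE _ _ (hT X) ≫ quoπ h' X ≫ g :=
  quoπ_quoMapApp_assoc h h' hS hT X g

lemma mono_quoMap_app (h : S ≤ T) (h' : S' ≤ T') (hS : S ≤ S') (hT : T ≤ T')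
    (X : BifilteredObject A) (h₁ : T.obj X ⊓ S'.obj X ≤ S.obj X) :
    Mono ((quoMap h h' hS hT).app X) := by
  refine Preadditive.mono_of_cancel_zero _ fun {B} z hz => ?_
  obtain ⟨B', π, _, t, ht⟩ := surjective_up_to_refinements_of_epi (quoπ h X) z
  rw [← cancel_epi π, comp_zero, ht, comp_quoπ_eq_zero_iff]
  refine factors_of_le _ h₁ ((inf_factors _).2 ⟨factors_comp_arrow _, ?_⟩)
  have := π ≫= hz
  rw [reassoc_of% ht, comp_zero, quoπ_quoMap_app, ← Category.assoc,
    comp_quoπ_eq_zero_iff] at this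
  simpa using this

/-- The second isomorphism theorem for subquotients. -/
lemma isIso_quoMap_app (h : S ≤ T) (h' : S' ≤ T') (hS : S ≤ S') (hT : T ≤ T')
    (X : BifilteredObject A) (h₁ : T.obj X ⊓ S'.obj X ≤ S.obj X)
    (h₂ : T'.obj X ≤ T.obj X ⊔ S'.obj X) : IsIso ((quoMap h h' hS hT).app X) := by
  have := mono_quoMap_app h h' hS hT X h₁
  have : Epi ((quoMap h h' hS hT).app X) := by
    rw [epi_iff_surjective_up_to_refinements]
    intro B z
    obtain ⟨B', π, _, t, ht⟩ := surjective_up_to_refinements_of_epi (quoπ h' X) z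
    obtain ⟨B'', π', _, x, s, hx⟩ := (factors_sup_iff (t ≫ (T'.obj X).arrow)).1
      (factors_of_le _ h₂ (factors_comp_arrow _))
    refine ⟨B'', π' ≫ π, inferInstance, x ≫ quoπ h X, ?_⟩
    rw [Category.assoc, ht, Category.assoc, quoπ_quoMap_app, ← sub_eq_zero, ← Category.assoc,
      ← Category.assoc, ← Preadditive.sub_comp, comp_quoπ_eq_zero_iff]
    have : (π' ≫ t - x ≫ (T.obj X).ofLE (T'.obj X) (hT X)) ≫ (T'.obj X).arrow =
        s ≫ (S'.obj X).arrow := by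
      simp [hx]
    rw [this]
    exact factors_comp_arrow _
  exact isIso_of_mono_of_epi _

/-- The short exact sequence `0 ⟶ T/S ⟶ U/S ⟶ U/T ⟶ 0`, as a short complex of functors. -/
noncomputable def quoShortComplex (h : S ≤ T) (h' : T ≤ U) :
    ShortComplex (BifilteredObject A ⥤ A) where
  X₁ := quo S T h
  X₂ := quo S U (le_trans' h h')
  X₃ := quo T U h'
  f := quoMap _ _ (fun _ => le_rfl) h'
  g := quoMap _ _ h (fun _ => le_rfl)
  zero := by
    ext X
    change _ = (0 : (quo S T h).obj X ⟶ _)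
    rw [← cancel_epi (quoπ h X), NatTrans.comp_app, quoπ_quoMap_app_assoc, quoπ_quoMap_app,
      comp_zero, ← Category.assoc, comp_quoπ_eq_zero_iff]
    simpa using factors_self _

lemma shortExact_quoShortComplex (h : S ≤ T) (h' : T ≤ U) (X : BifilteredObject A) :
    ((quoShortComplex h h').map ((evaluation _ _).obj X)).ShortExact := by
  have : Mono ((quoShortComplex h h').map ((evaluation _ _).obj X)).f := by
    exact mono_quoMap_app h (le_trans' h h') (fun _ => le_rfl) h' X _root_.inf_le_right
  have : Epi ((quoShortComplex h h').map ((evaluation _ _).obj X)).g := by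
    change Epi ((quoMap (le_trans' h h') h' h (fun _ => le_rfl)).app X)
    refine epi_of_epi_fac (f := quoπ (le_trans' h h') X) (h := quoπ h' X) ?_
    rw [quoπ_quoMap_app, ofLE_refl, Category.id_comp]
  refine { exact := ?_ }
  rw [ShortComplex.exact_iff_exact_up_to_refinements]
  intro B (z : B ⟶ (quo S U (le_trans' h h')).obj X)
    (hz : z ≫ (quoMap (le_trans' h h') h' h (fun _ => le_rfl)).app X = 0)
  obtain ⟨B', π, _, t, ht⟩ := surjective_up_to_refinements_of_epi (quoπ (le_trans' h h') X) z
  have hz' : t ≫ quoπ (le_trans' h h') X ≫ (quoMap (le_trans' h h') h' h (fun _ => le_rfl)).app X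
      = 0 := by
    rw [← Category.assoc, ← ht, Category.assoc, hz, comp_zero]
  rw [quoπ_quoMap_app, ofLE_refl, Category.id_comp, comp_quoπ_eq_zero_iff] at hz'
  refine ⟨B', π, inferInstance, factorThru _ _ hz' ≫ quoπ h X, ht.trans ?_⟩
  change _ = (_ ≫ _) ≫ (quoMap h (le_trans' h h') (fun _ => le_rfl) h').app X
  rw [Category.assoc, quoπ_quoMap_app, ← Category.assoc]
  congr 1
  rw [← cancel_mono (U.obj X).arrow]
  simp

lemma isZero_quo_obj (h : S ≤ T) (X : BifilteredObject A) (hX : T.obj X ≤ S.obj X) :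
    IsZero ((quo S T h).obj X) := by
  rw [IsZero.iff_id_eq_zero, ← cancel_epi (quoπ h X), Category.comp_id, comp_zero,
    ← Category.id_comp (quoπ h X), comp_quoπ_eq_zero_iff]
  simpa using factors_of_le _ hX (factors_self _)

end NaturalSubobject

/-! ### Bigraded pieces and one-sided quotients -/

namespace NaturalSubobject

variable {A : Type u} [Category.{v} A] [Abelian A]
variable {S T U S' T' : NaturalSubobject A}

lemma low_le_low (p q p' q' : ℤ) (hp : p ≤ p') (hq : q' ≤ q) :
    low (A := A) p q ≤ low p' q' :=
  fun X => sup_le_sup (X.W_mono (by lia)) (X.F_anti (by lia))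

lemma le_top' (S : NaturalSubobject A) : S ≤ ⊤ := fun _ => le_top

lemma WFlow_le_WF (p q : ℤ) : WFlow (A := A) p q ≤ WF p q := fun X => X.WFlow_le p q

lemma WFlow_le_low (p q : ℤ) : WFlow (A := A) p q ≤ low p q :=
  fun _ => sup_le_sup _root_.inf_le_left _root_.inf_le_right

lemma le_sup_left' : S ≤ S ⊔ T := fun _ => le_sup_left

lemma le_sup_right' : T ≤ S ⊔ T := fun _ => le_sup_right

lemma low_sup_WF_le (p q : ℤ) : low (A := A) p q ⊔ WF p q ≤ low (p + 1) q :=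
  fun X => sup_le (sup_le_sup (X.W_mono (by lia)) le_rfl)
    (_root_.inf_le_left.trans (le_sup_of_le_left (X.W_mono (by lia))))

lemma low_sup_WF_le' (p q : ℤ) : low (A := A) p q ⊔ WF p q ≤ low p (q - 1) :=
  fun X => sup_le (sup_le_sup le_rfl (X.F_anti (by lia)))
    (_root_.inf_le_right.trans (le_sup_of_le_right (X.F_anti (by lia))))

lemma WF_inf_low_le (p q : ℤ) (X : BifilteredObject A) :
    (WF p q).obj X ⊓ (low p q).obj X ≤ (WFlow p q).obj X := by
  change (X.W p ⊓ X.F q) ⊓ (X.W (p - 1) ⊔ X.F (q + 1)) ≤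
    (X.W (p - 1) ⊓ X.F q) ⊔ (X.W p ⊓ X.F (q + 1))
  have h1 : X.W (p - 1) ≤ X.W p := X.W_mono (by lia)
  have h2 : X.F (q + 1) ≤ X.F q := X.F_anti (by lia)
  rw [inf_comm, ← inf_assoc, sup_inf_assoc_of_le _ h1, inf_comm (X.F (q + 1)),
    sup_comm, sup_comm (X.W (p - 1) ⊓ X.F q),
    sup_inf_assoc_of_le _ (_root_.inf_le_right.trans h2)]

lemma low_inf_low_le (p q : ℤ) (X : BifilteredObject A) :
    (low (p + 1) q).obj X ⊓ (low p (q - 1)).obj X ≤ (low p q ⊔ WF p q).obj X := by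
  change (X.W (p + 1 - 1) ⊔ X.F (q + 1)) ⊓ (X.W (p - 1) ⊔ X.F (q - 1 + 1)) ≤
    (X.W (p - 1) ⊔ X.F (q + 1)) ⊔ (X.W p ⊓ X.F q)
  rw [add_sub_cancel_right, sub_add_cancel]
  have h1 : X.W (p - 1) ≤ X.W p := X.W_mono (by lia)
  have h2 : X.F (q + 1) ≤ X.F q := X.F_anti (by lia)
  rw [inf_comm, sup_inf_assoc_of_le _ (h1.trans le_sup_left), inf_comm (X.F q),
    sup_comm (X.W p), sup_inf_assoc_of_le _ h2, sup_assoc]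

/-- A dévissage principle: a property of subquotients which is invariant under the second
isomorphism theorem and stable under extensions passes from the bigraded pieces to the quotients
`X / (W_{p-1} + F^{q+1})`, provided that it holds where these vanish because the filtrations are
finite. -/
lemma quo_induction (P : ∀ S T : NaturalSubobject A, S ≤ T → Prop)
    (iso : ∀ {S T S' T' : NaturalSubobject A} (h : S ≤ T) (h' : S' ≤ T'), S ≤ S' → T ≤ T' →
      (∀ X, T.obj X ⊓ S'.obj X ≤ S.obj X) → (∀ X, T'.obj X ≤ T.obj X ⊔ S'.obj X) →
      (P S T h ↔ P S' T' h'))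
    (mid : ∀ {S T U : NaturalSubobject A} (h : S ≤ T) (h' : T ≤ U),
      P S T h → P T U h' → P S U (le_trans' h h'))
    (zM : ∀ p, ∃ q₀, ∀ q ≤ q₀, P (low p q) (low (p + 1) q) (low_le_low _ _ _ _ (by lia) le_rfl))
    (zL : ∀ q, ∃ p₀, ∀ p ≥ p₀, P (low p q) ⊤ (le_top' _))
    (hgr : ∀ p q, P (WFlow p q) (WF p q) (WFlow_le_WF p q)) (p q : ℤ) :
    P (low p q) ⊤ (le_top' _) := by
  -- The quotient `low (p + 1) q / low p q` is treated by ascending induction on `q`: it is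
  -- an extension of the same quotient for `q - 1` by the bigraded piece in bidegree `(p, q)`.
  have hM (p q : ℤ) : P (low p q) (low (p + 1) q) (low_le_low _ _ _ _ (by lia) le_rfl) := by
    obtain ⟨q₀, hq₀⟩ := zM p
    obtain hq | hq := le_total q q₀
    · exact hq₀ q hq
    · induction q, hq using Int.leInduction with
      | base => exact hq₀ _ le_rfl
      | succ q hq ih =>
        refine mid (T := low p (q + 1) ⊔ WF p (q + 1)) le_sup_left' (low_sup_WF_le _ _) ?_ ?_
        · exact (iso (WFlow_le_WF _ _) le_sup_left' (WFlow_le_low _ _) le_sup_right'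
            (WF_inf_low_le _ _) (fun _ => (sup_comm _ _).le)).1 (hgr _ _)
        · refine (iso _ (low_le_low p q (p + 1) q (by lia) le_rfl) ?_
            (low_le_low _ _ _ _ le_rfl (by lia)) ?_ ?_).2 ih
          · simpa using low_sup_WF_le' (A := A) p (q + 1)
          · simpa using low_inf_low_le (A := A) p (q + 1)
          · exact fun X => sup_le_sup le_sup_left le_rfl |>.trans' (by
              refine sup_le_sup le_rfl le_sup_right |>.trans' ?_
              change X.W _ ⊔ X.F (q + 1) ≤ (X.W _) ⊔ X.F (q + 1)
              exact le_rfl)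
  -- Then `X / low p q` is treated by descending induction on `p`.
  obtain ⟨p₀, hp₀⟩ := zL q
  obtain hp | hp := le_total p₀ p
  · exact hp₀ p hp
  · induction p, hp using Int.leInductionDown with
    | base => exact hp₀ _ le_rfl
    | pred p hp ih =>
      have := hM (p - 1) q
      refine mid (T := low (p - 1 + 1) q) (low_le_low _ _ _ _ (by lia) le_rfl) (le_top' _)
        (hM _ _) ?_
      simpa using ih

/-- The quotient functor `X ↦ X / (W_{p-1} + F^{q+1})`. -/
noncomputable abbrev lowQuo (p q : ℤ) : BifilteredObject A ⥤ A := quo (low p q) ⊤ (le_top' _)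

end NaturalSubobject

/-! ### Exactness and isomorphisms on bigraded pieces -/

namespace NaturalSubobject

variable {A : Type u} [Category.{v} A] [Abelian A]
variable {S T U S' T' : NaturalSubobject A}

instance (p q : ℤ) : (BifilteredObject.gr (A := A) p q).Additive :=
  inferInstanceAs (quo (WFlow p q) (WF p q) (WFlow_le_WF p q)).Additive

lemma exists_F_eq_top (X : BifilteredObject A) : ∃ q₀, ∀ q ≤ q₀, X.F q = ⊤ := by
  obtain ⟨q₀, h⟩ := X.F_top
  exact ⟨q₀, fun q hq => top_le_iff.1 (h ▸ X.F_anti hq)⟩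

lemma exists_W_eq_top (X : BifilteredObject A) : ∃ p₀, ∀ p ≥ p₀, X.W p = ⊤ := by
  obtain ⟨q₀, h⟩ := X.W_top
  exact ⟨q₀, fun q hq => top_le_iff.1 (h ▸ X.W_mono hq)⟩

lemma exists_F_eq_bot (X : BifilteredObject A) : ∃ q₀, ∀ q ≥ q₀, X.F q = ⊥ := by
  obtain ⟨q₀, h⟩ := X.F_bot
  exact ⟨q₀, fun q hq => le_bot_iff.1 (h ▸ X.F_anti hq)⟩

lemma exists_W_eq_bot (X : BifilteredObject A) : ∃ p₀, ∀ p ≤ p₀, X.W p = ⊥ := by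
  obtain ⟨q₀, h⟩ := X.W_bot
  exact ⟨q₀, fun q hq => le_bot_iff.1 (h ▸ X.W_mono hq)⟩

lemma exists_isZero_quo_low (X : BifilteredObject A) (p : ℤ) : ∃ q₀, ∀ q ≤ q₀,
    IsZero ((quo (low p q) (low (p + 1) q) (low_le_low _ _ _ _ (by lia) le_rfl)).obj X) := by
  obtain ⟨q₀, h⟩ := exists_F_eq_top X
  refine ⟨q₀ - 1, fun q hq => isZero_quo_obj _ _ (le_top.trans (le_sup_of_le_right ?_))⟩
  rw [h _ (by lia)]

lemma exists_isZero_lowQuo (X : BifilteredObject A) (q : ℤ) : ∃ p₀, ∀ p ≥ p₀,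
    IsZero ((lowQuo p q).obj X) := by
  obtain ⟨p₀, h⟩ := exists_W_eq_top X
  refine ⟨p₀ + 1, fun q hq => isZero_quo_obj _ _ (le_top.trans (le_sup_of_le_left ?_))⟩
  rw [h _ (by lia)]

/-- A morphism of bifiltered objects which is an isomorphism on bigraded pieces is an isomorphism
on the quotients `X / (W_{p-1} + F^{q+1})`. -/
lemma isIso_lowQuo_map_of_gr {X Y : BifilteredObject A} (f : X ⟶ Y)
    (hf : ∀ p q, IsIso ((BifilteredObject.gr p q).map f)) (p q : ℤ) :
    IsIso ((lowQuo p q).map f) := by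
  refine quo_induction (fun S T h => IsIso ((quo S T h).map f)) ?_ ?_ ?_ ?_ hf p q
  · intro S T S' T' h h' hS hT h₁ h₂
    have := isIso_quoMap_app h h' hS hT X (h₁ X) (h₂ X)
    have := isIso_quoMap_app h h' hS hT Y (h₁ Y) (h₂ Y)
    exact (MorphismProperty.isomorphisms A).arrow_mk_iso_iff
      (Arrow.isoMk (asIso ((quoMap h h' hS hT).app X)) (asIso ((quoMap h h' hS hT).app Y)))
  · intro S T U h h' h₁ h₃
    let φ : (quoShortComplex h h').map ((evaluation _ _).obj X) ⟶
        (quoShortComplex h h').map ((evaluation _ _).obj Y) :=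
      { τ₁ := (quo S T h).map f
        τ₂ := (quo S U (le_trans' h h')).map f
        τ₃ := (quo T U h').map f
        comm₁₂ := (quoShortComplex h h').f.naturality f
        comm₂₃ := (quoShortComplex h h').g.naturality f }
    have : IsIso φ.τ₁ := h₁
    have : IsIso φ.τ₃ := h₃
    exact ShortComplex.isIso₂_of_shortExact_of_isIso₁₃ φ
      (shortExact_quoShortComplex h h' X) (shortExact_quoShortComplex h h' Y)
  · intro p
    obtain ⟨q₀, h₀⟩ := exists_isZero_quo_low X p
    obtain ⟨q₁, h₁⟩ := exists_isZero_quo_low Y p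
    exact ⟨min q₀ q₁, fun q hq => isIso_of_source_target_iso_zero _
      (h₀ q (by lia)).isoZero (h₁ q (by lia)).isoZero⟩
  · intro p
    obtain ⟨q₀, h₀⟩ := exists_isZero_lowQuo X p
    obtain ⟨q₁, h₁⟩ := exists_isZero_lowQuo Y p
    exact ⟨max q₀ q₁, fun q hq => isIso_of_source_target_iso_zero _
      (h₀ q (by lia)).isoZero (h₁ q (by lia)).isoZero⟩

/-- The complex of subquotients of a complex of bifiltered objects. -/
noncomputable abbrev quoComplex (h : S ≤ T) (K : CochainComplex (BifilteredObject A) ℤ) :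
    CochainComplex A ℤ :=
  ((quo S T h).mapHomologicalComplex _).obj K

/-- The short complex of complexes given by `quoShortComplex` in each degree. -/
noncomputable def quoComplexShortComplex (h : S ≤ T) (h' : T ≤ U)
    (K : CochainComplex (BifilteredObject A) ℤ) : ShortComplex (CochainComplex A ℤ) where
  X₁ := quoComplex h K
  X₂ := quoComplex (le_trans' h h') K
  X₃ := quoComplex h' K
  f := (NatTrans.mapHomologicalComplex
    (quoMap h (le_trans' h h') (fun _ => le_rfl) h') _).app K
  g := (NatTrans.mapHomologicalComplex
    (quoMap (le_trans' h h') h' h (fun _ => le_rfl)) _).app K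
  zero := by
    ext n
    exact NatTrans.congr_app (quoShortComplex h h').zero (K.X n)

lemma shortExact_quoComplexShortComplex (h : S ≤ T) (h' : T ≤ U)
    (K : CochainComplex (BifilteredObject A) ℤ) : (quoComplexShortComplex h h' K).ShortExact :=
  HomologicalComplex.shortExact_of_degreewise_shortExact _
    fun n => shortExact_quoShortComplex h h' (K.X n)

lemma exactAt_quoComplex_iff (h : S ≤ T) (h' : S' ≤ T') (hS : S ≤ S') (hT : T ≤ T')
    (h₁ : ∀ X, T.obj X ⊓ S'.obj X ≤ S.obj X) (h₂ : ∀ X, T'.obj X ≤ T.obj X ⊔ S'.obj X)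
    (K : CochainComplex (BifilteredObject A) ℤ) (n : ℤ) :
    (quoComplex h K).ExactAt n ↔ (quoComplex h' K).ExactAt n := by
  have : IsIso ((NatTrans.mapHomologicalComplex (quoMap h h' hS hT) (ComplexShape.up ℤ)).app K) := by
    have (i : ℤ) : IsIso
      (((NatTrans.mapHomologicalComplex (quoMap h h' hS hT) (ComplexShape.up ℤ)).app K).f i) :=
      isIso_quoMap_app h h' hS hT _ (h₁ _) (h₂ _)
    exact HomologicalComplex.Hom.isIso_of_components _
  let e := asIso ((NatTrans.mapHomologicalComplex (quoMap h h' hS hT) (ComplexShape.up ℤ)).app K)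
  exact ⟨fun H => H.of_iso e, fun H => H.of_iso e.symm⟩

/-- A complex of bifiltered objects is acyclic on bigraded pieces if and only if it is acyclic
on the quotients by `W_{p-1} + F^{q+1}`. No uniform bound on the filtrations is needed. -/
lemma acyclic_gr_iff (K : CochainComplex (BifilteredObject A) ℤ) :
    (∀ p q, (((BifilteredObject.gr p q).mapHomologicalComplex (ComplexShape.up ℤ)).obj K).Acyclic) ↔
      ∀ p q, (((lowQuo p q).mapHomologicalComplex (ComplexShape.up ℤ)).obj K).Acyclic := by
  constructor
  · intro hK p q n
    refine quo_induction (fun S T h => (quoComplex h K).ExactAt n) ?_ ?_ ?_ ?_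
      (fun p q => hK p q n) p q
    · intro S T S' T' h h' hS hT h₁ h₂
      exact exactAt_quoComplex_iff h h' hS hT h₁ h₂ K n
    · intro S T U h h' h₁ h₃
      exact (shortExact_quoComplexShortComplex h h' K).exactAt_X₂ n h₁ h₃
    · intro p
      obtain ⟨q₀, h₀⟩ := exists_isZero_quo_low (K.X n) p
      exact ⟨q₀, fun q hq => HomologicalComplex.ExactAt.of_isZero (h₀ q hq)⟩
    · intro p
      obtain ⟨q₀, h₀⟩ := exists_isZero_lowQuo (K.X n) p
      exact ⟨q₀, fun q hq => HomologicalComplex.ExactAt.of_isZero (h₀ q hq)⟩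
  -- Conversely, the bigraded piece is the kernel of `X / low p q ⟶ X / low (p + 1) q`, followed
  -- by the kernel of the projection from this quotient for `q` to the one for `q - 1`.
  · intro hK p q n
    have ker {S T U : NaturalSubobject A} (h : S ≤ T) (h' : T ≤ U)
        (h₂ : (quoComplex (le_trans' h h') K).Acyclic) (h₃ : (quoComplex h' K).Acyclic) :
        (quoComplex h K).Acyclic :=
      (shortExact_quoComplexShortComplex h h' K).acyclic_X₁ (by
        rw [quasiIso_iff]
        intro i
        rw [quasiIsoAt_iff_exactAt]
        · exact h₃ i
        · exact h₂ i)
    have hM (p q : ℤ) :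
        (quoComplex (low_le_low p q (p + 1) q (by lia) le_rfl) K).Acyclic :=
      ker _ (le_top' _) (hK p q) (hK (p + 1) q)
    refine (exactAt_quoComplex_iff (WFlow_le_WF _ _) le_sup_left' (WFlow_le_low _ _) le_sup_right'
      (WF_inf_low_le _ _) (fun _ => (sup_comm _ _).le) K n).2 ?_
    refine ker _ (low_sup_WF_le p q) (hM p q) (fun i => ?_) n
    refine (exactAt_quoComplex_iff _ (low_le_low p (q - 1) (p + 1) (q - 1) (by lia) le_rfl)
      (low_sup_WF_le' p q) (low_le_low _ _ _ _ le_rfl (by lia)) (low_inf_low_le p q) (fun X => ?_)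
      K i).2 (hM p (q - 1) i)
    exact sup_le_sup le_sup_left le_sup_right

end NaturalSubobject

/-! ### Bifiltered objects concentrated in one bidegree -/

namespace BifilteredObject

open NaturalSubobject
open scoped ZeroObject

variable {A : Type u} [Category.{v} A] [Abelian A]

/-- The object `J` of `A` placed in bidegree `(p, q)`. -/
noncomputable def pure (p q : ℤ) (J : A) : BifilteredObject A where
  X := J
  W k := if p ≤ k then ⊤ else ⊥
  F k := if k ≤ q then ⊤ else ⊥
  W_mono i j h := by
    dsimp only
    split_ifs <;> first | exact le_rfl | exact bot_le | lia
  F_anti i j h := by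
    dsimp only
    split_ifs <;> first | exact le_rfl | exact bot_le | lia
  W_bot := ⟨p - 1, if_neg (by lia)⟩
  W_top := ⟨p, if_pos le_rfl⟩
  F_bot := ⟨q + 1, if_neg (by lia)⟩
  F_top := ⟨q, if_pos le_rfl⟩

lemma pure_W_of_le {p q k : ℤ} (J : A) (h : p ≤ k) : (pure p q J).W k = ⊤ := if_pos h
lemma pure_W_of_lt {p q k : ℤ} (J : A) (h : k < p) : (pure p q J).W k = ⊥ := if_neg (by lia)
lemma pure_F_of_le {p q k : ℤ} (J : A) (h : k ≤ q) : (pure p q J).F k = ⊤ := if_pos h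
lemma pure_F_of_lt {p q k : ℤ} (J : A) (h : q < k) : (pure p q J).F k = ⊥ := if_neg (by lia)

lemma mapsInto_ite {X Y : A} {f : X ⟶ Y} {S : Subobject X} {P : Prop} [Decidable P]
    (h : ¬ P → S.arrow ≫ f = 0) : MapsInto f S (if P then ⊤ else ⊥) := by
  split_ifs with hP
  · exact mapsInto_iff_imageOf_le.2 le_top
  · unfold MapsInto
    rw [h hP]
    exact factors_zero

lemma mapsInto_ite_ite {X Y : A} (f : X ⟶ Y) (P : Prop) [Decidable P] :
    MapsInto f (if P then ⊤ else ⊥) (if P then ⊤ else ⊥) :=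
  mapsInto_ite fun h => by rw [if_neg h, bot_arrow, zero_comp]

/-- Placing an object in bidegree `(p, q)`, as a functor. -/
noncomputable def pureFunctor (p q : ℤ) : A ⥤ BifilteredObject A where
  obj J := pure p q J
  map f :=
    { val := f
      mapsInto_W _ := mapsInto_ite_ite f _
      mapsInto_F _ := mapsInto_ite_ite f _ }

/-! ### Finite biproducts of bifiltered objects -/

instance : HasZeroObject (BifilteredObject A) :=
  ⟨pure 0 0 (0 : A), (IsZero.iff_id_eq_zero _).2 (hom_ext ((isZero_zero A).eq_of_src _ _))⟩

section

variable {X Y : A}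

/-- The direct sum of two subobjects. -/
noncomputable def sumSubobject (S : Subobject X) (T : Subobject Y) : Subobject (X ⊞ Y) :=
  (Subobject.pullback biprod.fst).obj S ⊓ (Subobject.pullback biprod.snd).obj T

lemma sumSubobject_mono {S S' : Subobject X} {T T' : Subobject Y} (h : S ≤ S') (h' : T ≤ T') :
    sumSubobject S T ≤ sumSubobject S' T' :=
  inf_le_inf ((Subobject.pullback _).monotone h) ((Subobject.pullback _).monotone h')

lemma sumSubobject_top : sumSubobject (⊤ : Subobject X) (⊤ : Subobject Y) = ⊤ := by
  simp [sumSubobject, pullback_top]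

lemma mapsInto_sumSubobject_iff {Z : A} {U : Subobject Z} (S : Subobject X) (T : Subobject Y)
    (f : Z ⟶ X ⊞ Y) : MapsInto f U (sumSubobject S T) ↔
      MapsInto (f ≫ biprod.fst) U S ∧ MapsInto (f ≫ biprod.snd) U T := by
  simp only [mapsInto_iff_le_pullback, pullback_comp, sumSubobject, inf_pullback, le_inf_iff]

lemma mapsInto_fst (S : Subobject X) (T : Subobject Y) :
    MapsInto biprod.fst (sumSubobject S T) S := by
  simpa using ((mapsInto_sumSubobject_iff S T (𝟙 _)).1 (mapsInto_id le_rfl)).1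

lemma mapsInto_snd (S : Subobject X) (T : Subobject Y) :
    MapsInto biprod.snd (sumSubobject S T) T := by
  simpa using ((mapsInto_sumSubobject_iff S T (𝟙 _)).1 (mapsInto_id le_rfl)).2

lemma sumSubobject_bot : sumSubobject (⊥ : Subobject X) (⊥ : Subobject Y) = ⊥ := by
  have h1 := mapsInto_fst (⊥ : Subobject X) (⊥ : Subobject Y)
  have h2 := mapsInto_snd (⊥ : Subobject X) (⊥ : Subobject Y)
  unfold MapsInto at h1 h2
  rw [bot_factors_iff_zero] at h1 h2
  refine le_bot_iff.1 (le_of_factors ((bot_factors_iff_zero _).2 ?_))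
  ext
  · simp [h1]
  · simp [h2]

end

/-- The direct sum of two bifiltered objects. -/
noncomputable def sum (X Y : BifilteredObject A) : BifilteredObject A where
  X := X.X ⊞ Y.X
  W p := sumSubobject (X.W p) (Y.W p)
  F q := sumSubobject (X.F q) (Y.F q)
  W_mono _ _ h := sumSubobject_mono (X.W_mono h) (Y.W_mono h)
  F_anti _ _ h := sumSubobject_mono (X.F_anti h) (Y.F_anti h)
  W_bot := by
    obtain ⟨a, ha⟩ := exists_W_eq_bot X
    obtain ⟨b, hb⟩ := exists_W_eq_bot Y
    exact ⟨min a b, by rw [ha _ (by lia), hb _ (by lia), sumSubobject_bot]⟩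
  W_top := by
    obtain ⟨a, ha⟩ := exists_W_eq_top X
    obtain ⟨b, hb⟩ := exists_W_eq_top Y
    exact ⟨max a b, by rw [ha _ (by lia), hb _ (by lia), sumSubobject_top]⟩
  F_bot := by
    obtain ⟨a, ha⟩ := exists_F_eq_bot X
    obtain ⟨b, hb⟩ := exists_F_eq_bot Y
    exact ⟨max a b, by rw [ha _ (by lia), hb _ (by lia), sumSubobject_bot]⟩
  F_top := by
    obtain ⟨a, ha⟩ := exists_F_eq_top X
    obtain ⟨b, hb⟩ := exists_F_eq_top Y
    exact ⟨min a b, by rw [ha _ (by lia), hb _ (by lia), sumSubobject_top]⟩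

/-- The direct sum of two bifiltered objects as a binary bicone. -/
@[simps]
noncomputable def sumBicone (X Y : BifilteredObject A) : BinaryBicone X Y where
  pt := sum X Y
  fst :=
    { val := biprod.fst
      mapsInto_W p := mapsInto_fst _ _
      mapsInto_F p := mapsInto_fst _ _ }
  snd :=
    { val := biprod.snd
      mapsInto_W p := mapsInto_snd _ _
      mapsInto_F p := mapsInto_snd _ _ }
  inl :=
    { val := biprod.inl
      mapsInto_W p := (mapsInto_sumSubobject_iff _ _ _).2
        ⟨by simpa using mapsInto_id le_rfl, by simpa using mapsInto_zero _ _⟩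
      mapsInto_F p := (mapsInto_sumSubobject_iff _ _ _).2
        ⟨by simpa using mapsInto_id le_rfl, by simpa using mapsInto_zero _ _⟩ }
  inr :=
    { val := biprod.inr
      mapsInto_W p := (mapsInto_sumSubobject_iff _ _ _).2
        ⟨by simpa using mapsInto_zero _ _, by simpa using mapsInto_id le_rfl⟩
      mapsInto_F p := (mapsInto_sumSubobject_iff _ _ _).2
        ⟨by simpa using mapsInto_zero _ _, by simpa using mapsInto_id le_rfl⟩ }
  inl_fst := hom_ext biprod.inl_fst
  inl_snd := hom_ext biprod.inl_snd
  inr_fst := hom_ext biprod.inr_fst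
  inr_snd := hom_ext biprod.inr_snd

instance : HasBinaryBiproducts (BifilteredObject A) where
  has_binary_biproduct X Y := hasBinaryBiproduct_of_total (sumBicone X Y) (hom_ext biprod.total)

instance : HasFiniteProducts (BifilteredObject A) := hasFiniteProducts_of_has_binary_and_terminal

instance : HasFiniteBiproducts (BifilteredObject A) := HasFiniteBiproducts.of_hasFiniteProducts

end BifilteredObject

/-! ### Maps into objects concentrated in one bidegree -/

namespace BifilteredObject

open NaturalSubobject

variable {A : Type u} [Category.{v} A] [Abelian A]

/-- The projection `X ⟶ X / (W_{p-1} + F^{q+1})`. -/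
noncomputable def toLow (p q : ℤ) (X : BifilteredObject A) : X.X ⟶ (lowQuo p q).obj X :=
  inv (⊤ : Subobject X.X).arrow ≫ quoπ (le_top' _) X

instance (p q : ℤ) (X : BifilteredObject A) : Epi (toLow p q X) := by
  unfold toLow; infer_instance

lemma comp_toLow_eq_zero_iff {p q : ℤ} {X : BifilteredObject A} {B : A} (x : B ⟶ X.X) :
    x ≫ toLow p q X = 0 ↔ (X.W (p - 1) ⊔ X.F (q + 1)).Factors x := by
  have h := comp_quoπ_eq_zero_iff (le_top' (low p q)) (x ≫ inv (⊤ : Subobject X.X).arrow)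
  rw [Category.assoc] at h
  refine h.trans ?_
  erw [Category.assoc, IsIso.inv_hom_id, Category.comp_id]
  rfl

lemma toLow_naturality (p q : ℤ) {X Y : BifilteredObject A} (f : X ⟶ Y) :
    toLow p q X ≫ (lowQuo p q).map f = f.val ≫ toLow p q Y := by
  unfold toLow
  rw [Category.assoc, quoπ_map, IsIso.inv_comp_eq, ← Category.assoc, ← Category.assoc]
  congr 1
  erw [← MapsInto.map_arrow (mapsInto_iff_imageOf_le.2 le_top :
    MapsInto f.val (⊤ : Subobject X.X) ⊤)]
  rw [Category.assoc]
  erw [IsIso.hom_inv_id, Category.comp_id]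

lemma toLow_naturality_assoc (p q : ℤ) {X Y : BifilteredObject A} (f : X ⟶ Y) {Z : A}
    (g : (lowQuo p q).obj Y ⟶ Z) :
    toLow p q X ≫ (lowQuo p q).map f ≫ g = f.val ≫ toLow p q Y ≫ g := by
  rw [← Category.assoc, toLow_naturality, Category.assoc]

/-- The morphism `X / (W_{p-1} + F^{q+1}) ⟶ B` induced by a morphism vanishing on `W_{p-1}` and
`F^{q+1}`. -/
noncomputable def descLow {p q : ℤ} {X : BifilteredObject A} {B : A} (g : X.X ⟶ B)
    (hW : (X.W (p - 1)).arrow ≫ g = 0) (hF : (X.F (q + 1)).arrow ≫ g = 0) :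
    (lowQuo p q).obj X ⟶ B :=
  cokernel.desc _ ((⊤ : Subobject X.X).arrow ≫ g) (by
    change Subobject.ofLE (X.W (p - 1) ⊔ X.F (q + 1)) ⊤ le_top ≫ _ = 0
    rw [← Category.assoc, ofLE_arrow]
    obtain ⟨T, π, _, s, s', h⟩ := (factors_sup_iff (X.W (p - 1) ⊔ X.F (q + 1)).arrow).1
      (factors_self _)
    rw [← cancel_epi π, ← Category.assoc, h]
    simp [hW, hF])

@[simp]
lemma toLow_descLow {p q : ℤ} {X : BifilteredObject A} {B : A} (g : X.X ⟶ B)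
    (hW : (X.W (p - 1)).arrow ≫ g = 0) (hF : (X.F (q + 1)).arrow ≫ g = 0) :
    toLow p q X ≫ descLow g hW hF = g := by
  unfold toLow
  rw [Category.assoc, IsIso.inv_comp_eq]
  exact cokernel.π_desc _ _ _

lemma arrow_W_toLow {p q k : ℤ} (X : BifilteredObject A) (hk : k < p) :
    (X.W k).arrow ≫ toLow p q X = 0 :=
  (comp_toLow_eq_zero_iff _).2 (factors_of_le _ (le_sup_of_le_left (X.W_mono (by lia)))
    (factors_self _))

lemma arrow_F_toLow {p q k : ℤ} (X : BifilteredObject A) (hk : q < k) :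
    (X.F k).arrow ≫ toLow p q X = 0 :=
  (comp_toLow_eq_zero_iff _).2 (factors_of_le _ (le_sup_of_le_right (X.F_anti (by lia)))
    (factors_self _))

lemma arrow_eq_zero_of_mapsInto_bot {X Y : A} {f : X ⟶ Y} {S : Subobject X} {T : Subobject Y}
    (h : MapsInto f S T) (hT : T = ⊥) : S.arrow ≫ f = 0 := by
  subst hT
  exact (bot_factors_iff_zero _).1 h

/-- The morphism to the object `J` in bidegree `(p, q)` given by a morphism factoring through
`X / (W_{p-1} + F^{q+1})`. -/
noncomputable def homPure {p q : ℤ} {X : BifilteredObject A} {J : A}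
    (g : (lowQuo p q).obj X ⟶ J) : X ⟶ (pureFunctor p q).obj J where
  val := toLow p q X ≫ g
  mapsInto_W k := mapsInto_ite (f := toLow p q X ≫ g) fun h => by
    rw [← Category.assoc, arrow_W_toLow X (by lia), zero_comp]
  mapsInto_F k := mapsInto_ite (f := toLow p q X ≫ g) fun h => by
    rw [← Category.assoc, arrow_F_toLow X (by lia), zero_comp]

/-- The morphism `X / (W_{p-1} + F^{q+1}) ⟶ J` given by a morphism to the object `J` in
bidegree `(p, q)`. -/
noncomputable def pureDesc {p q : ℤ} {X : BifilteredObject A} {J : A}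
    (φ : X ⟶ (pureFunctor p q).obj J) : (lowQuo p q).obj X ⟶ J :=
  descLow φ.val
    (arrow_eq_zero_of_mapsInto_bot (φ.mapsInto_W (p - 1)) (pure_W_of_lt J (by lia)))
    (arrow_eq_zero_of_mapsInto_bot (φ.mapsInto_F (q + 1)) (pure_F_of_lt J (by lia)))

lemma toLow_pureDesc {p q : ℤ} {X : BifilteredObject A} {J : A}
    (φ : X ⟶ (pureFunctor p q).obj J) : toLow p q X ≫ pureDesc φ = φ.val :=
  toLow_descLow _ _ _

/-- Morphisms from `X` to the object `J` in bidegree `(p, q)` are the morphisms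
`X / (W_{p-1} + F^{q+1}) ⟶ J`. -/
noncomputable def lowQuoAdjunction (p q : ℤ) : lowQuo (A := A) p q ⊣ pureFunctor p q :=
  Adjunction.mkOfHomEquiv
    { homEquiv X J :=
        { toFun g := homPure g
          invFun φ := pureDesc φ
          left_inv g := by
            rw [← cancel_epi (toLow p q X)]
            exact toLow_pureDesc _
          right_inv φ := hom_ext (toLow_pureDesc _) }
      homEquiv_naturality_left_symm {X' X J} f g := by
        change pureDesc (f ≫ g) = (lowQuo p q).map f ≫ pureDesc g
        rw [← cancel_epi (toLow p q X'), toLow_naturality_assoc]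
        exact (toLow_pureDesc _).trans (f.val ≫= (toLow_pureDesc g).symm)
      homEquiv_naturality_right {X J J'} f g := hom_ext (Category.assoc _ _ _).symm }

/-! ### Relatively injective bifiltered objects -/

/-- A bifiltered object `I` has the extension property if morphisms to `I` extend along the
second map of every short complex which is exact on the quotients by `W_{p-1} + F^{q+1}`. -/
def HasExtension (I : BifilteredObject A) : Prop :=
  ∀ S : ShortComplex (BifilteredObject A), (∀ p q, (S.map (lowQuo p q)).Exact) →
    ∀ φ : S.X₂ ⟶ I, S.f ≫ φ = 0 → ∃ ψ : S.X₃ ⟶ I, S.g ≫ ψ = φ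

lemma HasExtension.of_retract {I E : BifilteredObject A} (hE : HasExtension E) (i : I ⟶ E)
    (r : E ⟶ I) (h : i ≫ r = 𝟙 I) : HasExtension I := by
  intro S hS φ hφ
  obtain ⟨ψ, hψ⟩ := hE S hS (φ ≫ i) (by rw [reassoc_of% hφ, zero_comp])
  exact ⟨ψ ≫ r, by rw [reassoc_of% hψ, h, Category.comp_id]⟩

lemma hasExtension_pure (p q : ℤ) (J : A) [Injective J] :
    HasExtension ((pureFunctor p q).obj J) := by
  intro S hS φ hφ
  have hφ' : (lowQuo p q).map S.f ≫ ((lowQuoAdjunction p q).homEquiv _ _).symm φ = 0 := by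
    rw [← Adjunction.homEquiv_naturality_left_symm, hφ]
    exact (((lowQuoAdjunction p q).homEquiv S.X₁ J).symm_apply_eq).2 (hom_ext comp_zero.symm)
  obtain ⟨ψ, hψ⟩ : ∃ ψ : (lowQuo p q).obj S.X₃ ⟶ J,
      (lowQuo p q).map S.g ≫ ψ = ((lowQuoAdjunction p q).homEquiv _ _).symm φ :=
    ⟨(hS p q).descToInjective _ hφ', (hS p q).comp_descToInjective _ hφ'⟩
  refine ⟨(lowQuoAdjunction p q).homEquiv _ _ ψ, ?_⟩
  rw [← Adjunction.homEquiv_naturality_left, ← Equiv.eq_symm_apply, hψ]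

lemma hasExtension_biproduct {ι : Type} [Finite ι] (E : ι → BifilteredObject A)
    (hE : ∀ i, HasExtension (E i)) : HasExtension (⨁ E) := by
  intro S hS φ hφ
  choose ψ hψ using fun i => hE i S hS (φ ≫ biproduct.π E i) (by rw [reassoc_of% hφ, zero_comp])
  exact ⟨biproduct.lift ψ, by ext i : 1; simp [hψ]⟩

lemma isZero_gr_pure {a b p q : ℤ} (h : (a, b) ≠ (p, q)) (J : A) :
    IsZero ((gr a b).obj ((pureFunctor p q).obj J)) := by
  refine isZero_quo_obj (WFlow_le_WF _ _) _ ?_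
  change (pure p q J).W a ⊓ (pure p q J).F b ≤ ((pure p q J).W (a - 1) ⊓ (pure p q J).F b) ⊔
    ((pure p q J).W a ⊓ (pure p q J).F (b + 1))
  obtain ha | rfl | ha := lt_trichotomy a p
  · rw [pure_W_of_lt J ha]; simp
  swap
  · rw [pure_W_of_le J (k := a - 1) (by lia)]; simp
  obtain hb | rfl | hb := lt_trichotomy b q
  · rw [pure_F_of_le J (k := b + 1) (by lia)]; simp
  · exact (h rfl).elim
  · rw [pure_F_of_lt J hb]; simp

/-- The comparison `Gr_p^W Gr_F^q X ⟶ X / (W_{p-1} + F^{q+1})`. -/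
noncomputable def grToLow (p q : ℤ) : gr (A := A) p q ⟶ lowQuo p q :=
  quoMap (WFlow_le_WF p q) (le_top' _) (WFlow_le_low p q) (le_top' _)

instance (p q : ℤ) (X : BifilteredObject A) : Mono ((grToLow p q).app X) :=
  mono_quoMap_app _ _ _ _ _ (WF_inf_low_le p q X)

instance (p q : ℤ) (J : A) : IsIso ((grToLow p q).app ((pureFunctor p q).obj J)) := by
  refine isIso_quoMap_app _ _ _ _ _ (WF_inf_low_le p q _) (le_sup_of_le_left ?_)
  change ⊤ ≤ (pure p q J).W p ⊓ (pure p q J).F q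
  rw [pure_W_of_le J le_rfl, pure_F_of_le J le_rfl, inf_top_eq]

instance (p q : ℤ) : (pureFunctor (A := A) p q).Faithful where
  map_injective h := congrArg Hom.val h

instance (p q : ℤ) : (pureFunctor (A := A) p q).Full where
  map_surjective f := ⟨f.val, rfl⟩

/-- The quotient by `W_{p-1} + F^{q+1}` of the object `J` in bidegree `(p, q)` is `J`. -/
noncomputable def lowQuoPureIso (p q : ℤ) (J : A) :
    (lowQuo p q).obj ((pureFunctor p q).obj J) ≅ J :=
  asIso ((lowQuoAdjunction p q).counit.app J)

@[simp]
lemma lowQuo_map_homPure_lowQuoPureIso_hom {p q : ℤ} {X : BifilteredObject A} {J : A}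
    (g : (lowQuo p q).obj X ⟶ J) :
    (lowQuo p q).map (homPure g) ≫ (lowQuoPureIso p q J).hom = g := by
  rw [← cancel_epi (toLow p q X), toLow_naturality_assoc]
  have h : toLow p q ((pureFunctor p q).obj J) ≫ (lowQuoPureIso p q J).hom = 𝟙 J :=
    toLow_pureDesc (𝟙 ((pureFunctor p q).obj J))
  exact ((homPure g).val ≫= h).trans (Category.comp_id _)

/-- `Gr_p^W Gr_F^q` of the object `J` in bidegree `(p, q)` is `J`. -/
noncomputable def grPureIso (p q : ℤ) (J : A) : (gr p q).obj ((pureFunctor p q).obj J) ≅ J :=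
  asIso ((grToLow p q).app ((pureFunctor p q).obj J)) ≪≫ lowQuoPureIso p q J

end BifilteredObject

namespace BifilteredObject

open NaturalSubobject

variable {A : Type u} [Category.{v} A] [Abelian A]

/-! ### Injective bigraded pieces -/

section

variable {ι : Type} [Fintype ι] (E : ι → BifilteredObject A) (G : BifilteredObject A ⥤ A)
  [G.Additive]

lemma isZero_map_biproduct (h : ∀ i, IsZero (G.obj (E i))) : IsZero (G.obj (⨁ E)) := by
  rw [IsZero.iff_id_eq_zero, ← G.map_id, ← biproduct.total, G.map_sum]
  refine Finset.sum_eq_zero fun i _ => ?_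
  rw [G.map_comp, (h i).eq_of_tgt (G.map (biproduct.π E i)) 0, zero_comp]

lemma isIso_map_biproduct_π (i₀ : ι) (h : ∀ i ≠ i₀, IsZero (G.obj (E i))) :
    IsIso (G.map (biproduct.π E i₀)) := by
  refine ⟨G.map (biproduct.ι E i₀), ?_, ?_⟩
  · rw [← G.map_id, ← biproduct.total, G.map_sum, Finset.sum_eq_single i₀]
    · rw [G.map_comp]
    · intro i _ hi
      rw [G.map_comp, (h i hi).eq_of_tgt (G.map (biproduct.π E i)) 0, zero_comp]
    · simp
  · rw [← G.map_comp, biproduct.ι_π_self, G.map_id]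

end

/-- Both filtrations of `X` are constant outside the interval `[-m, m]`. -/
structure IsBoundedBy (X : BifilteredObject A) (m : ℤ) : Prop where
  W_bot : ∀ k < -m, X.W k = ⊥
  W_top : ∀ k ≥ m, X.W k = ⊤
  F_top : ∀ k ≤ -m, X.F k = ⊤
  F_bot : ∀ k > m, X.F k = ⊥

lemma IsBoundedBy.mono {X : BifilteredObject A} {m m' : ℤ} (h : X.IsBoundedBy m) (hm : m ≤ m') :
    X.IsBoundedBy m' :=
  ⟨fun k hk => h.W_bot k (by lia), fun k hk => h.W_top k (by lia), fun k hk => h.F_top k (by lia),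
    fun k hk => h.F_bot k (by lia)⟩

lemma exists_isBoundedBy (X : BifilteredObject A) : ∃ m, X.IsBoundedBy m := by
  obtain ⟨a, ha⟩ := exists_W_eq_bot X
  obtain ⟨b, hb⟩ := exists_W_eq_top X
  obtain ⟨c, hc⟩ := exists_F_eq_top X
  obtain ⟨d, hd⟩ := exists_F_eq_bot X
  exact ⟨max (max (-a) b) (max (-c) d), fun k hk => ha k (by lia), fun k hk => hb k (by lia),
    fun k hk => hc k (by lia), fun k hk => hd k (by lia)⟩

/-- The square of bidegrees `[-m, m] × [-m, m]`. -/
abbrev Box (m : ℤ) : Type := ↥(Finset.Icc (-m) m ×ˢ Finset.Icc (-m) m)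

lemma IsBoundedBy.isZero_gr {X : BifilteredObject A} {m : ℤ} (h : X.IsBoundedBy m) {p q : ℤ}
    (hpq : (p, q) ∉ Finset.Icc (-m) m ×ˢ Finset.Icc (-m) m) : IsZero ((gr p q).obj X) := by
  refine isZero_quo_obj (WFlow_le_WF _ _) _ ?_
  change X.W p ⊓ X.F q ≤ (X.W (p - 1) ⊓ X.F q) ⊔ (X.W p ⊓ X.F (q + 1))
  simp only [Finset.mem_product, Finset.mem_Icc] at hpq
  by_cases h1 : p < -m
  · simp [h.W_bot p h1]
  by_cases h2 : p > m
  · simp [h.W_top (p - 1) (by lia)]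
  by_cases h3 : q < -m
  · simp [h.F_top (q + 1) (by lia)]
  · simp [h.F_bot q (by lia)]

/-- The direct sum of the objects `J i` placed in bidegrees `i`, for `i` in a square. -/
noncomputable abbrev sumPure {m : ℤ} (J : Box m → A) : BifilteredObject A :=
  ⨁ fun i : Box m => (pureFunctor i.1.1 i.1.2).obj (J i)

lemma isZero_gr_sumPure {m : ℤ} (J : Box m → A) {p q : ℤ}
    (hpq : (p, q) ∉ Finset.Icc (-m) m ×ˢ Finset.Icc (-m) m) :
    IsZero ((gr p q).obj (sumPure J)) :=
  isZero_map_biproduct _ _ fun i => isZero_gr_pure (fun h => hpq (by rw [h]; exact i.2)) _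

lemma isIso_gr_map_π {m : ℤ} (J : Box m → A) (i : Box m) :
    IsIso ((gr i.1.1 i.1.2).map
      (biproduct.π (fun i : Box m => (pureFunctor i.1.1 i.1.2).obj (J i)) i)) :=
  isIso_map_biproduct_π _ _ i fun _ hj => isZero_gr_pure (fun h => hj (Subtype.ext h.symm)) _

lemma injective_gr_sumPure {m : ℤ} (J : Box m → A) [∀ i, Injective (J i)] (p q : ℤ) :
    Injective ((gr p q).obj (sumPure J)) := by
  by_cases hpq : (p, q) ∈ Finset.Icc (-m) m ×ˢ Finset.Icc (-m) m
  · let f : (gr p q).obj (sumPure J) ⟶ (gr p q).obj ((pureFunctor p q).obj (J ⟨(p, q), hpq⟩)) :=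
      (gr p q).map (biproduct.π (fun i : Box m => (pureFunctor i.1.1 i.1.2).obj (J i))
        ⟨(p, q), hpq⟩)
    have : IsIso f := isIso_gr_map_π J ⟨(p, q), hpq⟩
    exact Injective.of_iso (asIso f ≪≫ grPureIso p q _).symm inferInstance
  · exact Injective.of_iso (isZero_gr_sumPure J hpq).isoZero.symm inferInstance

lemma isIso_of_lowQuo {X Y : BifilteredObject A} (f : X ⟶ Y)
    (hf : ∀ p q, IsIso ((lowQuo p q).map f)) : IsIso f := by
  obtain ⟨m₁, h₁⟩ := exists_isBoundedBy X
  obtain ⟨m₂, h₂⟩ := exists_isBoundedBy Y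
  obtain ⟨m, hX, hY⟩ : ∃ m, X.IsBoundedBy m ∧ Y.IsBoundedBy m :=
    ⟨max m₁ m₂, h₁.mono (by lia), h₂.mono (by lia)⟩
  have key {B : A} (x : B ⟶ X.X) (p q : ℤ)
      (hx : (Y.W (p - 1) ⊔ Y.F (q + 1)).Factors (x ≫ f.val)) :
      (X.W (p - 1) ⊔ X.F (q + 1)).Factors x := by
    rw [← comp_toLow_eq_zero_iff] at hx ⊢
    rw [← cancel_mono ((lowQuo p q).map f), zero_comp, Category.assoc, toLow_naturality,
      ← Category.assoc, hx]
  have iso (Z : BifilteredObject A) (hZ : Z.IsBoundedBy m) : IsIso (toLow (-m) m Z) := by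
    have : Mono (toLow (-m) m Z) := Preadditive.mono_of_cancel_zero _ fun x hx => by
      rw [comp_toLow_eq_zero_iff, hZ.W_bot _ (by lia), hZ.F_bot _ (by lia), bot_sup_eq,
        bot_factors_iff_zero] at hx
      exact hx
    exact isIso_of_mono_of_epi _
  have := iso X hX
  have := iso Y hY
  have : IsIso f.val := by
    have h := toLow_naturality (-m) m f
    have : IsIso (f.val ≫ toLow (-m) m Y) := by rw [← h]; infer_instance
    exact IsIso.of_isIso_comp_right _ (toLow (-m) m Y)
  refine ⟨{ val := inv f.val, mapsInto_W := fun k => ?_, mapsInto_F := fun k => ?_ },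
    hom_ext (IsIso.hom_inv_id _), hom_ext (IsIso.inv_hom_id _)⟩
  · have := key ((Y.W k).arrow ≫ inv f.val) (k + 1) m (by
      simpa [hY.F_bot (m + 1) (by lia)] using factors_self _)
    simpa [hX.F_bot (m + 1) (by lia), MapsInto] using this
  · have := key ((Y.F k).arrow ≫ inv f.val) (-m) (k - 1) (by
      simpa [hY.W_bot (-m - 1) (by lia)] using factors_self _)
    simpa [hX.W_bot (-m - 1) (by lia), MapsInto] using this

/-- A bifiltered object with injective bigraded pieces is the direct sum of these pieces, placed in
their bidegrees; in particular it has the extension property. -/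
lemma hasExtension_of_injective_gr (I : BifilteredObject A)
    [∀ p q, Injective ((gr p q).obj I)] : HasExtension I := by
  obtain ⟨m, hm⟩ := exists_isBoundedBy I
  let J (i : Box m) : A := (gr i.1.1 i.1.2).obj I
  -- A retraction of `Gr_p^W Gr_F^q I ⟶ I / (W_{p-1} + F^{q+1})` exists by injectivity.
  let ρ (p q : ℤ) : (lowQuo p q).obj I ⟶ (gr p q).obj I :=
    Injective.factorThru (𝟙 _) ((grToLow p q).app I)
  let e : I ⟶ sumPure J := biproduct.lift fun i => homPure (ρ i.1.1 i.1.2)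
  have he (p q : ℤ) : IsIso ((gr p q).map e) := by
    by_cases hpq : (p, q) ∈ Finset.Icc (-m) m ×ˢ Finset.Icc (-m) m
    · have := isIso_gr_map_π J ⟨(p, q), hpq⟩
      have h₁ : (gr p q).map (homPure (ρ p q)) ≫ (grPureIso p q _).hom = 𝟙 _ := by
        refine ((grToLow p q).naturality_assoc _ _).trans ?_
        refine ((grToLow p q).app I ≫= lowQuo_map_homPure_lowQuoPureIso_hom _).trans ?_
        exact Injective.comp_factorThru _ _
      have h₃ : IsIso ((gr p q).map e ≫
          (gr p q).map (biproduct.π _ (⟨(p, q), hpq⟩ : Box m))) := by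
        rw [← Functor.map_comp, biproduct.lift_π]
        have : (gr p q).map (homPure (ρ p q)) = inv (grPureIso p q _).hom := by
          rw [← cancel_mono (grPureIso p q _).hom, h₁, IsIso.inv_hom_id]
        change IsIso ((gr p q).map (homPure (ρ p q)))
        rw [this]
        infer_instance
      exact IsIso.of_isIso_comp_right _
        ((gr p q).map (biproduct.π _ (⟨(p, q), hpq⟩ : Box m)))
    · exact isIso_of_source_target_iso_zero _
        (hm.isZero_gr hpq).isoZero (isZero_gr_sumPure J hpq).isoZero
  have := isIso_of_lowQuo e (isIso_lowQuo_map_of_gr e he)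
  exact HasExtension.of_retract (hasExtension_biproduct _ fun i => hasExtension_pure _ _ _)
    e (inv e) (by simp)

/-! ### Injective envelopes -/

/-- The projection `X / (W_{p-1} + F^{q+1}) ⟶ X / (W_{p'-1} + F^{q'+1})` for `p ≤ p'`
and `q' ≤ q`. -/
noncomputable def lowQuoTrans (p q p' q' : ℤ) (hp : p ≤ p') (hq : q' ≤ q) :
    lowQuo (A := A) p q ⟶ lowQuo p' q' :=
  quoMap _ _ (low_le_low _ _ _ _ hp hq) (fun _ => le_rfl)

lemma IsBoundedBy.isIso_lowQuoTrans {X : BifilteredObject A} {m : ℤ} (h : X.IsBoundedBy m)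
    (p q : ℤ) :
    IsIso ((lowQuoTrans p q (max p (-m)) (min q m) (by lia) (by lia)).app X) := by
  refine isIso_quoMap_app _ _ _ _ _ (_root_.inf_le_right.trans ?_) le_sup_left
  refine sup_le_sup ?_ ?_
  · by_cases hp : p < -m
    · rw [h.W_bot _ (by lia)]; exact bot_le
    · rw [max_eq_left (by lia)]
  · by_cases hq : m < q
    · rw [h.F_bot _ (by lia)]; exact bot_le
    · rw [min_eq_left (by lia)]

lemma IsBoundedBy.isZero_lowQuo {X : BifilteredObject A} {m : ℤ} (h : X.IsBoundedBy m)
    {p q : ℤ} (hpq : m < p ∨ q < -m) : IsZero ((lowQuo p q).obj X) := by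
  refine isZero_quo_obj _ _ (le_top.trans ?_)
  change _ ≤ X.W (p - 1) ⊔ X.F (q + 1)
  obtain hp | hq := hpq
  · rw [h.W_top _ (by lia)]; exact le_sup_left
  · rw [h.F_top _ (by lia)]; exact le_sup_right

/-- Every morphism `d : X' ⟶ X` has a "cokernel followed by an embedding into an injective":
a morphism from `X` to an object with injective bigraded pieces which becomes, after applying any of
the right exact functors `X ↦ X / (W_{p-1} + F^{q+1})`, exact together with `d`. -/
lemma exists_injective_envelope [EnoughInjectives A] {X' X : BifilteredObject A} (d : X' ⟶ X) :
    ∃ (E : BifilteredObject A) (ε : X ⟶ E) (w : d ≫ ε = 0),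
      (∀ p q, Injective ((gr p q).obj E)) ∧
      ∀ p q, ((ShortComplex.mk d ε w).map (lowQuo p q)).Exact := by
  obtain ⟨m₁, h₁⟩ := exists_isBoundedBy X
  obtain ⟨m₂, h₂⟩ := exists_isBoundedBy X'
  obtain ⟨m, hX, hX'⟩ : ∃ m, X.IsBoundedBy m ∧ X'.IsBoundedBy m :=
    ⟨max m₁ m₂, h₁.mono (by lia), h₂.mono (by lia)⟩
  let J (p q : ℤ) : A := Injective.under (cokernel ((lowQuo p q).map d))
  let g (p q : ℤ) : (lowQuo p q).obj X ⟶ J p q := cokernel.π _ ≫ Injective.ι _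
  let ε : X ⟶ sumPure (fun i : Box m => J i.1.1 i.1.2) :=
    biproduct.lift fun i => homPure (g i.1.1 i.1.2)
  have w : d ≫ ε = 0 := by
    ext i : 1
    rw [Category.assoc, biproduct.lift_π, zero_comp]
    refine hom_ext ?_
    change d.val ≫ toLow i.1.1 i.1.2 X ≫ g i.1.1 i.1.2 = 0
    rw [← toLow_naturality_assoc, cokernel.condition_assoc, zero_comp, comp_zero]
  refine ⟨_, ε, w, fun p q => injective_gr_sumPure _ p q, fun p q => ?_⟩
  rw [ShortComplex.exact_iff_exact_up_to_refinements]
  intro B (x : B ⟶ (lowQuo p q).obj X) (hx : x ≫ (lowQuo p q).map ε = 0)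
  -- Reduction to bidegrees in the square, by clamping.
  let p' := max p (-m)
  let q' := min q m
  let τ := lowQuoTrans (A := A) p q p' q' (by lia) (by lia)
  have : IsIso (τ.app X) := hX.isIso_lowQuoTrans p q
  have : IsIso (τ.app X') := hX'.isIso_lowQuoTrans p q
  obtain ⟨B', π, _, y, hy⟩ : ∃ (B' : A) (π : B' ⟶ B) (_ : Epi π) (y : B' ⟶ (lowQuo p' q').obj X'),
      π ≫ x ≫ τ.app X = y ≫ (lowQuo p' q').map d := by
    by_cases hpq : (p', q') ∈ Finset.Icc (-m) m ×ˢ Finset.Icc (-m) m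
    · have h₃ : (x ≫ τ.app X) ≫ (lowQuo p' q').map ε = 0 := by
        rw [Category.assoc, ← τ.naturality, reassoc_of% hx, zero_comp]
      have h₄ : (x ≫ τ.app X) ≫ g p' q' = 0 := by
        have h₆ : ε ≫ biproduct.π _ (⟨(p', q'), hpq⟩ : Box m) = homPure (g p' q') :=
          biproduct.lift_π _ _
        rw [← lowQuo_map_homPure_lowQuoPureIso_hom (g p' q'), ← h₆, Functor.map_comp,
          ← Category.assoc, ← Category.assoc, h₃, zero_comp, zero_comp]
      have h₇ : (x ≫ τ.app X) ≫ cokernel.π ((lowQuo p' q').map d) = 0 := by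
        rw [← cancel_mono (Injective.ι _), zero_comp, Category.assoc]
        exact h₄
      obtain ⟨B', π, hπ, y, hy⟩ := (CokernelCofork.IsColimit.comp_π_eq_zero_iff_up_to_refinements
        (cokernelIsCokernel ((lowQuo p' q').map d)) _).1 h₇
      exact ⟨B', π, hπ, y, hy⟩
    · refine ⟨B, 𝟙 _, inferInstance, 0, IsZero.eq_of_tgt (hX.isZero_lowQuo ?_) _ _⟩
      simp only [Finset.mem_product, Finset.mem_Icc] at hpq
      lia
  let z : B' ⟶ (lowQuo p q).obj X' := y ≫ inv (τ.app X')
  refine ⟨B', π, inferInstance, z, ?_⟩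
  change π ≫ x = (y ≫ inv (τ.app X')) ≫ (lowQuo p q).map d
  rw [← cancel_mono (τ.app X), Category.assoc, hy, Category.assoc, τ.naturality]
  rw [Category.assoc, IsIso.inv_hom_id_assoc]

end BifilteredObject

/-! ### Morphisms to complexes with injective bigraded pieces -/

namespace BifilteredObject

open NaturalSubobject CochainComplex HomComplex Pretriangulated

variable {A : Type u} [Category.{v} A] [Abelian A]

lemma acyclic_mappingCone_iff {K L : CochainComplex A ℤ} (f : K ⟶ L) :
    (mappingCone f).Acyclic ↔ QuasiIso f := by
  rw [← HomotopyCategory.quotient_obj_mem_subcategoryAcyclic_iff_acyclic,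
    ← HomologicalComplex.mem_quasiIso_iff, ← HomotopyCategory.quotient_map_mem_quasiIso_iff,
    HomotopyCategory.quasiIso_eq_trW_subcategoryAcyclic]
  exact ((HomotopyCategory.subcategoryAcyclic A).trW_iff_of_distinguished _
    (HomotopyCategory.mappingCone_triangleh_distinguished f)).symm

lemma acyclic_map_mappingCone_iff {K L : CochainComplex (BifilteredObject A) ℤ} (f : K ⟶ L)
    (G : BifilteredObject A ⥤ A) [G.Additive] :
    ((G.mapHomologicalComplex (ComplexShape.up ℤ)).obj (mappingCone f)).Acyclic ↔
      QuasiIso ((G.mapHomologicalComplex (ComplexShape.up ℤ)).map f) := by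
  rw [← acyclic_mappingCone_iff]
  let e := mappingCone.mapHomologicalComplexIso f G
  exact ⟨fun h n => (h n).of_iso e, fun h n => (h n).of_iso e.symm⟩

/-- The quasi-isomorphisms on bigraded pieces are the quasi-isomorphisms on all quotients
by `W_{p-1} + F^{q+1}`. -/
lemma quasiIso_gr_iff {K L : CochainComplex (BifilteredObject A) ℤ} (f : K ⟶ L) :
    (∀ p q, QuasiIso (((gr p q).mapHomologicalComplex (ComplexShape.up ℤ)).map f)) ↔
      ∀ p q, QuasiIso (((lowQuo p q).mapHomologicalComplex (ComplexShape.up ℤ)).map f) := by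
  simp only [← acyclic_map_mappingCone_iff]
  exact acyclic_gr_iff _

lemma exists_extension_of_acyclic {K : CochainComplex (BifilteredObject A) ℤ}
    {I : BifilteredObject A} (hI : HasExtension I)
    (hK : ∀ p q, (((lowQuo p q).mapHomologicalComplex (ComplexShape.up ℤ)).obj K).Acyclic)
    (n : ℤ) (u : K.X (n + 1) ⟶ I) (hu : K.d n (n + 1) ≫ u = 0) :
    ∃ β : K.X (n + 2) ⟶ I, K.d (n + 1) (n + 2) ≫ β = u := by
  refine hI (ShortComplex.mk (K.d n (n + 1)) (K.d (n + 1) (n + 2)) (K.d_comp_d _ _ _))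
    (fun p q => ?_) u hu
  have := hK p q (n + 1)
  rw [HomologicalComplex.exactAt_iff' _ n (n + 1) (n + 2) (by simp) (by simp; lia)] at this
  exact this

/-- One step of the construction of a contracting homotopy: a cochain `α` of degree `-1` whose
coboundary agrees with `f` up to degree `n` is corrected in degree `n + 1`. -/
lemma exists_correction {K L : CochainComplex (BifilteredObject A) ℤ}
    (f : K ⟶ L) (α : Cochain K L (-1)) (n m : ℤ) (hnm : n + 1 = m)
    (hK : ∀ p q, (((lowQuo p q).mapHomologicalComplex (ComplexShape.up ℤ)).obj K).Acyclic)
    (hL : HasExtension (L.X m))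
    (hα : (δ (-1) 0 α).EqUpTo (Cochain.ofHom f) n) :
    ∃ (h : K.X (n + 2) ⟶ L.X (n + 1)),
      (δ (-1) 0 (α + Cochain.single h (-1))).EqUpTo (Cochain.ofHom f) m := by
  subst hnm
  let u := f.f (n + 1) - α.v (n + 1) n (by lia) ≫ L.d n (n + 1) -
    K.d (n + 1) (n + 2) ≫ α.v (n + 2) (n + 1) (by lia)
  have hu : K.d n (n + 1) ≫ u = 0 := by
    have eq := hα n n (add_zero n) (by rfl)
    simp only [δ_v (-1) 0 (neg_add_cancel 1) α n n (add_zero _) (n - 1) (n + 1)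
      (by lia) (by lia), Int.negOnePow_zero, one_smul, Cochain.ofHom_v] at eq
    simp only [u, Preadditive.comp_sub, HomologicalComplex.d_comp_d_assoc, zero_comp,
      ← f.comm, ← eq, Preadditive.add_comp, Category.assoc, L.d_comp_d, comp_zero, zero_add,
      sub_self]
  obtain ⟨β, hβ⟩ := exists_extension_of_acyclic hL hK n u hu
  refine ⟨β, ?_⟩
  intro p q hpq hp
  obtain rfl : p = q := by lia
  obtain hp | rfl := hp.lt_or_eq
  · rw [δ_add, Cochain.add_v, hα p p (by lia) (by lia), add_eq_left,
      δ_v (-1) 0 (neg_add_cancel 1) _ p p hpq (p - 1) (p + 1) rfl rfl,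
      Cochain.single_v_eq_zero _ _ _ _ _ (by lia),
      Cochain.single_v_eq_zero _ _ _ _ _ (by lia)]
    simp
  · rw [δ_v (-1) 0 (neg_add_cancel 1) _ (n + 1) (n + 1) (by lia) n (n + 2)
      (by lia) (by lia), Cochain.add_v,
      Cochain.single_v_eq_zero _ _ _ _ _ (by lia)]
    simp [hβ, u]

open Cochain.InductionUp in
/-- Morphisms from an acyclic complex to a bounded below complex of objects with the extension
property are homotopic to zero: approximate contracting homotopies are built degree by degree, and
have a limit. -/
lemma nonempty_homotopy_zero {K L : CochainComplex (BifilteredObject A) ℤ} (d : ℤ)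
    [L.IsStrictlyGE d] (f : K ⟶ L)
    (hK : ∀ p q, (((lowQuo p q).mapHomologicalComplex (ComplexShape.up ℤ)).obj K).Acyclic)
    (hL : ∀ n, HasExtension (L.X n)) : Nonempty (Homotopy f 0) := by
  let X (n : ℕ) : Set (Cochain K L (-1)) :=
    Set.ofPred (fun α => (δ (-1) 0 α).EqUpTo (Cochain.ofHom f) (n + d - 1))
  let x₀ : X 0 := ⟨0, fun p q hpq hp ↦
    IsZero.eq_of_tgt (L.isZero_of_isStrictlyGE d _ (by lia)) _ _⟩
  let φ (n : ℕ) (α : X n) : X (n + 1) :=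
    ⟨_, (exists_correction f α.1 (n + d - 1) ((n + 1 : ℕ) + d - 1)
      (by lia) hK (hL _) α.2).choose_spec⟩
  have hφ (k : ℕ) (x : X k) : (φ k x).1.EqUpTo x.1 (d + k) := fun p q hpq hp => by
    dsimp [φ]
    rw [add_eq_left, Cochain.single_v_eq_zero _ _ _ _ _ (by lia)]
  refine ⟨(Cochain.equivHomotopy f 0).symm ⟨limitSequence φ hφ x₀, ?_⟩⟩
  rw [Cochain.ofHom_zero, add_zero]
  ext n
  let k₀ := (n - d + 1).toNat
  rw [← (sequence φ x₀ k₀).2 n n (add_zero n) (by lia),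
    δ_v (-1) 0 (neg_add_cancel 1) _ n n (by lia) (n - 1) (n + 1) rfl (by lia),
    δ_v (-1) 0 (neg_add_cancel 1) _ n n (by lia) (n - 1) (n + 1) rfl (by lia),
    limitSequence_eqUpTo φ hφ x₀ k₀ n (n - 1) (by lia) (by lia),
    limitSequence_eqUpTo φ hφ x₀ k₀ (n + 1) n (by lia) (by lia)]

lemma bijective_precomp_of_distinguished {C : Type*} [Category* C] [HasZeroObject C]
    [HasShift C ℤ] [Preadditive C] [∀ n : ℤ, (CategoryTheory.shiftFunctor C n).Additive]
    [Pretriangulated C] (T : Triangle C) (hT : T ∈ distTriang C) (N : C)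
    (h₀ : ∀ f : T.obj₃ ⟶ N, f = 0) (h₁ : ∀ f : T.obj₃ ⟶ N⟦(1 : ℤ)⟧, f = 0) :
    Function.Bijective (fun g : T.obj₂ ⟶ N => T.mor₁ ≫ g) := by
  constructor
  · intro g₁ g₂ (hg : T.mor₁ ≫ g₁ = T.mor₁ ≫ g₂)
    rw [← sub_eq_zero]
    obtain ⟨k, hk⟩ := Triangle.yoneda_exact₂ _ hT (g₁ - g₂) (by
      rw [Preadditive.comp_sub, hg, sub_self])
    rw [hk, h₀ k, comp_zero]
  · intro f
    obtain ⟨k, hk⟩ := Triangle.yoneda_exact₃ _ (rot_of_distTriang _ hT) (f⟦(1 : ℤ)⟧') (h₁ _)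
    obtain ⟨g, rfl⟩ := (CategoryTheory.shiftFunctor C (1 : ℤ)).map_surjective (X := T.obj₂)
      (Y := N) k
    refine ⟨-g, (CategoryTheory.shiftFunctor C (1 : ℤ)).map_injective ?_⟩
    have hk' : f⟦(1 : ℤ)⟧' = (-T.mor₁⟦(1 : ℤ)⟧') ≫ g⟦(1 : ℤ)⟧' := hk
    simp [hk']

/-- Homotopy classes of morphisms to a bounded below complex with injective bigraded pieces are
invariant under quasi-isomorphisms on bigraded pieces: the mapping cone has no nonzero morphisms to
it in the homotopy category. -/
lemma bijective_precomp_homotopyCategory {X Y M : CochainComplex (BifilteredObject A) ℤ}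
    (w : X ⟶ Y) (hw : ∀ p q, QuasiIso (((gr p q).mapHomologicalComplex (ComplexShape.up ℤ)).map w))
    (d : ℤ) [M.IsStrictlyGE d] (hM : ∀ p q n, Injective ((gr p q).obj (M.X n))) :
    Function.Bijective (fun g : (HomotopyCategory.quotient _ _).obj Y ⟶
      (HomotopyCategory.quotient _ _).obj M => (HomotopyCategory.quotient _ _).map w ≫ g) := by
  have hcone : ∀ p q, (((lowQuo p q).mapHomologicalComplex (ComplexShape.up ℤ)).obj
      (mappingCone w)).Acyclic :=
    fun p q => (acyclic_map_mappingCone_iff w _).2 ((quasiIso_gr_iff w).1 hw p q)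
  have orth {N : CochainComplex (BifilteredObject A) ℤ} (d : ℤ) [N.IsStrictlyGE d]
      (hN : ∀ n, HasExtension (N.X n)) (f : (HomotopyCategory.quotient _ _).obj (mappingCone w) ⟶
        (HomotopyCategory.quotient _ _).obj N) : f = 0 := by
    obtain ⟨f, rfl⟩ := (HomotopyCategory.quotient _ _).map_surjective f
    rw [HomotopyCategory.eq_of_homotopy f 0 (nonempty_homotopy_zero d f hcone hN).some,
      Functor.map_zero]
  have hM' (n : ℤ) : HasExtension (M.X n) := by
    have (p q : ℤ) := hM p q n
    exact hasExtension_of_injective_gr _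
  refine bijective_precomp_of_distinguished _
    (HomotopyCategory.mappingCone_triangleh_distinguished w) _ (orth d hM') ?_
  rw [HomotopyCategory.shift_quotient_obj]
  have : (M⟦(1 : ℤ)⟧).IsStrictlyGE (d - 1) := M.isStrictlyGE_shift d 1 (d - 1) (by lia)
  exact orth (d - 1) (fun n => hM' (n + 1))

end BifilteredObject

/-! ### Injective resolutions of bifiltered complexes -/

namespace BifilteredObject

open NaturalSubobject
open scoped ZeroObject

variable {A : Type u} [Category.{v} A] [Abelian A]

/-- A morphism of complexes is a quasi-isomorphism if its mapping cone is acyclic, as expressed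
with generalised elements. -/
lemma quasiIso_of_exact_up_to_refinements {X Y : CochainComplex A ℤ} (φ : X ⟶ Y)
    (h : ∀ (k : ℤ) ⦃T : A⦄ (x : T ⟶ X.X (k + 1 + 1)) (y : T ⟶ Y.X (k + 1)),
      x ≫ φ.f (k + 1 + 1) = y ≫ Y.d (k + 1) (k + 1 + 1) →
      ∃ (T' : A) (π : T' ⟶ T) (_ : Epi π) (x' : T' ⟶ X.X (k + 1)) (y' : T' ⟶ Y.X k),
        π ≫ x = x' ≫ X.d (k + 1) (k + 1 + 1) ∧
          π ≫ y = x' ≫ φ.f (k + 1) + y' ≫ Y.d k (k + 1)) :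
    QuasiIso φ := by
  rw [quasiIso_iff]
  intro n
  rw [quasiIsoAt_iff_isIso_homologyMap]
  have : Mono (HomologicalComplex.homologyMap φ n) := by
    obtain ⟨k, rfl⟩ : ∃ k : ℤ, n = k + 1 + 1 := ⟨n - 2, by lia⟩
    rw [HomologicalComplex.mono_homologyMap_iff_up_to_refinements φ (k + 1) (k + 1 + 1)
      (k + 1 + 1 + 1) (by simp) (by simp)]
    intro T x _ y hy
    obtain ⟨T', π, hπ, x', y', hx', _⟩ := h k x y hy
    exact ⟨T', π, hπ, x', hx'⟩
  have : Epi (HomologicalComplex.homologyMap φ n) := by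
    obtain ⟨k, rfl⟩ : ∃ k : ℤ, n = k + 1 := ⟨n - 1, by lia⟩
    rw [HomologicalComplex.epi_homologyMap_iff_up_to_refinements φ k (k + 1)
      (k + 1 + 1) (by simp) (by simp)]
    intro T y hy
    obtain ⟨T', π, hπ, x', y', hx', hy'⟩ := h k 0 y (by rw [hy, zero_comp])
    exact ⟨T', π, hπ, x', by rw [← hx', comp_zero], y', hy'⟩
  exact isIso_of_mono_of_epi _

/-- The part of a resolution `f : K ⟶ I` around degree `m`: the objects `P = I^{m-1}` and `I = I^m`
together with the map `K^m ⊕ I^{m-1} ⟶ I^m` whose components are `f^m` and the differential. -/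
structure ResolutionStage (K : CochainComplex (BifilteredObject A) ℤ) (m : ℤ) where
  P : BifilteredObject A
  I : BifilteredObject A
  a : K.X m ⊞ P ⟶ I
  injective : ∀ p q, Injective ((gr p q).obj I)

namespace ResolutionStage

variable {K : CochainComplex (BifilteredObject A) ℤ} {m : ℤ}

/-- The differential `K^m ⊕ I^{m-1} ⟶ K^{m+1} ⊕ I^m` of the mapping cone. -/
noncomputable def coneD (s : ResolutionStage K m) : K.X m ⊞ s.P ⟶ K.X (m + 1) ⊞ s.I :=
  biprod.lift (biprod.fst ≫ (-K.d m (m + 1))) s.a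

/-- A stage `t` in degree `m + 1` prolongs a stage `s` in degree `m` if the object of `s` is
the previous object of `t` and the mapping cone becomes exact after passing to the quotients by
`W_{p-1} + F^{q+1}`. -/
def Step (s : ResolutionStage K m) (t : ResolutionStage K (m + 1)) : Prop :=
  ∃ (e : s.I ≅ t.P) (w : s.coneD ≫ biprod.map (𝟙 _) e.hom ≫ t.a = 0),
    ∀ p q, ((ShortComplex.mk s.coneD (biprod.map (𝟙 _) e.hom ≫ t.a) w).map (lowQuo p q)).Exact

lemma exists_step [EnoughInjectives A] (s : ResolutionStage K m) : ∃ t, s.Step t := by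
  obtain ⟨E, ε, w, hE, hε⟩ := exists_injective_envelope s.coneD
  have h : biprod.map (𝟙 (K.X (m + 1))) (𝟙 s.I) = 𝟙 _ := by
    apply biprod.hom_ext' <;> simp
  have h' : biprod.map (𝟙 (K.X (m + 1))) (Iso.refl s.I).hom ≫ ε = ε := by
    rw [Iso.refl_hom, h, Category.id_comp]
  refine ⟨⟨s.I, E, ε, hE⟩, Iso.refl _, (s.coneD ≫= h').trans w, fun p q => ?_⟩
  have h'' := hε p q
  convert h''

variable (K m) in
/-- The stage whose objects are zero. -/
noncomputable def zero : ResolutionStage K m where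
  P := 0
  I := 0
  a := 0
  injective p q := ((gr p q).map_isZero (isZero_zero _)).injective

lemma zero_step (h : IsZero (K.X (m + 1))) : (zero K m).Step (zero K (m + 1)) := by
  refine ⟨Iso.refl _, (isZero_zero _).eq_of_tgt _ _, fun p q => ?_⟩
  refine ShortComplex.exact_of_isZero_X₂ _ ((lowQuo p q).map_isZero ?_)
  exact (biprod_isZero_iff _ _).2 ⟨h, isZero_zero _⟩

lemma exists_family [EnoughInjectives A] (K : CochainComplex (BifilteredObject A) ℤ) (N : ℤ)
    [K.IsStrictlyGE N] : ∃ s : ∀ m, ResolutionStage K m,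
      (∀ m, (s m).Step (s (m + 1))) ∧ ∀ m < N, s m = zero K m := by
  -- The stages are zero up to degree `N - 1`, and are then prolonged one by one.
  let s (m : ℤ) : ResolutionStage K m := Int.inductionOn' m (N - 1) (zero K (N - 1))
    (fun _ _ t => t.exists_step.choose) (fun k _ _ => zero K (k - 1))
  have hs (m : ℤ) (hm : m < N) : s m = zero K m := by
    obtain rfl | hm := eq_or_ne m (N - 1)
    · exact Int.inductionOn'_self ..
    · obtain ⟨k, rfl⟩ : ∃ k, m = k - 1 := ⟨m + 1, by lia⟩
      exact Int.inductionOn'_sub_one (hz := by lia)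
  refine ⟨s, fun m => ?_, hs⟩
  by_cases hm : m + 1 < N
  · rw [hs m (by lia), hs (m + 1) hm]
    exact zero_step (K.isZero_of_isStrictlyGE N _ hm)
  · have : s (m + 1) = (s m).exists_step.choose :=
      Int.inductionOn'_add_one (hz := by lia)
    rw [this]
    exact (s m).exists_step.choose_spec

end ResolutionStage

open ResolutionStage in
/-- Every bounded below complex maps to a complex with injective bigraded pieces by
a quasi-isomorphism on bigraded pieces. -/
lemma exists_injective_resolution [EnoughInjectives A]
    (K : CochainComplex (BifilteredObject A) ℤ) (N : ℤ) [K.IsStrictlyGE N] :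
    ∃ (I : CochainComplex (BifilteredObject A) ℤ) (f : K ⟶ I), I.IsStrictlyGE N ∧
      (∀ p q n, Injective ((gr p q).obj (I.X n))) ∧
      ∀ p q, QuasiIso (((gr p q).mapHomologicalComplex (ComplexShape.up ℤ)).map f) := by
  obtain ⟨s, hs, hs₀⟩ := exists_family K N
  choose e w hex using hs
  let d (m : ℤ) : (s m).I ⟶ (s (m + 1)).I := (e m).hom ≫ biprod.inr ≫ (s (m + 1)).a
  let φ (m : ℤ) : K.X m ⟶ (s m).I := biprod.inl ≫ (s m).a
  have ha (m : ℤ) : biprod.map (𝟙 (K.X (m + 1))) (e m).hom ≫ (s (m + 1)).a =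
      biprod.desc (φ (m + 1)) (d m) := by
    apply biprod.hom_ext' <;> simp [φ, d]
  have hφd (m : ℤ) : φ m ≫ d m = K.d m (m + 1) ≫ φ (m + 1) := by
    have := biprod.inl ≫= w m
    rw [ha, coneD, biprod.lift_desc, comp_zero] at this
    simp only [Preadditive.comp_add, Category.assoc, biprod.inl_fst_assoc,
      Preadditive.neg_comp] at this
    rw [neg_add_eq_zero] at this
    simpa [φ] using this.symm
  have hdd (m : ℤ) : d m ≫ d (m + 1) = 0 := by
    have := biprod.inr ≫= w (m + 1)
    rw [ha, coneD, biprod.lift_desc, comp_zero] at this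
    simp only [Preadditive.comp_add, Category.assoc, biprod.inr_fst_assoc, zero_comp,
      zero_add] at this
    simp only [d, Category.assoc] at this ⊢
    rw [this, comp_zero]
  let I : CochainComplex (BifilteredObject A) ℤ := CochainComplex.of (fun m => (s m).I) d hdd
  have hId (m : ℤ) : I.d m (m + 1) = d m := CochainComplex.of_d _ d m
  let f : K ⟶ I :=
    { f := φ
      comm' := by
        rintro i _ rfl
        exact (φ i ≫= hId i).trans (hφd i) }
  refine ⟨I, f, ?_, fun p q n => (s n).injective p q, (quasiIso_gr_iff f).2 fun p q => ?_⟩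
  · rw [CochainComplex.isStrictlyGE_iff]
    intro m hm
    change IsZero (s m).I
    rw [hs₀ m hm]
    exact isZero_zero _
  · refine quasiIso_of_exact_up_to_refinements _ fun k T x y hxy => ?_
    let L := lowQuo (A := A) p q
    change T ⟶ L.obj (K.X (k + 1 + 1)) at x
    change T ⟶ L.obj (s (k + 1)).I at y
    replace hxy : x ≫ L.map (φ (k + 1 + 1)) = y ≫ L.map (d (k + 1)) :=
      hxy.trans (y ≫= congrArg L.map (hId (k + 1)))
    -- The cycle `(-x, y)` of the mapping cone is a boundary.
    have hex' := (ShortComplex.exact_iff_exact_up_to_refinements _).1 (hex (k + 1) p q)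
    obtain ⟨T', π, hπ, z, hz⟩ := hex' (-x ≫ L.map biprod.inl + y ≫ L.map biprod.inr) (by
      refine ((-x ≫ L.map biprod.inl + y ≫ L.map biprod.inr) ≫=
        congrArg L.map (ha (k + 1))).trans ?_
      simp only [Preadditive.add_comp, Category.assoc, ← Functor.map_comp, Preadditive.neg_comp,
        biprod.inl_desc, biprod.inr_desc, hxy, neg_add_cancel]
      rfl)
    change T' ⟶ L.obj (K.X (k + 1) ⊞ (s (k + 1)).P) at z
    change π ≫ (-x ≫ L.map biprod.inl + y ≫ L.map biprod.inr) = z ≫ L.map (s (k + 1)).coneD at hz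
    have hz₁ := hz =≫ L.map biprod.fst
    have hz₂ := hz =≫ L.map biprod.snd
    simp only [coneD, Category.assoc, ← Functor.map_comp, Preadditive.add_comp,
      Preadditive.neg_comp, Preadditive.comp_neg, biprod.inl_fst, biprod.inr_fst,
      biprod.inl_snd, biprod.inr_snd, Functor.map_zero, comp_zero, neg_zero,
      zero_add, add_zero, biprod.lift_fst, biprod.lift_snd, Functor.map_neg,
      neg_inj] at hz₁ hz₂
    rw [L.map_id, Category.comp_id] at hz₁ hz₂
    refine ⟨T', π, hπ, z ≫ L.map biprod.fst, z ≫ L.map (biprod.snd ≫ (e k).inv), ?_, ?_⟩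
    · exact hz₁.trans ((z ≫= L.map_comp _ _).trans (Category.assoc _ _ _).symm)
    · refine hz₂.trans ?_
      refine Eq.trans ?_ (congrArg₂ (· + ·) rfl
        ((z ≫ L.map (biprod.snd ≫ (e k).inv)) ≫= congrArg L.map (hId k).symm))
      change _ = (z ≫ L.map biprod.fst) ≫ L.map (φ (k + 1)) +
        (z ≫ L.map (biprod.snd ≫ (e k).inv)) ≫ L.map (d k)
      simp only [Category.assoc, ← Functor.map_comp, ← Preadditive.comp_add, ← Functor.map_add,
        φ, d, Iso.inv_hom_id_assoc]
      rw [← Category.assoc, ← Category.assoc biprod.snd, ← Preadditive.add_comp, biprod.total,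
        Category.id_comp]

end BifilteredObject

/-! ### Homotopies that preserve both filtrations -/

namespace BifilteredComplex

open BifilteredObject

variable {A : Type u} [Category.{v} A] [Abelian A]

/-- The components of an `(r,0)`-homotopy, as morphisms of `A`. -/
lemma nonempty_rHomotopy_iff (r : ℕ) {K L : BifilteredComplex A} (f g : K ⟶ L) :
    Nonempty (RHomotopy r f g) ↔ ∃ h : ∀ n : ℤ, (K.deg (n + 1)).X ⟶ (L.deg n).X,
      (∀ n p, MapsInto (h n) ((K.deg (n + 1)).W p) ((L.deg n).W (p + r))) ∧
      (∀ n q, MapsInto (h n) ((K.deg (n + 1)).F q) ((L.deg n).F q)) ∧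
      ∀ n, h n ≫ (L.diff n (n + 1)).val + (K.diff (n + 1) (n + 1 + 1)).val ≫ h (n + 1) =
        (comp g (n + 1)).val - (comp f (n + 1)).val := by
  constructor
  · rintro ⟨H⟩
    refine ⟨fun n => (H.h n).val, fun n p => ?_, fun n => (H.h n).mapsInto_F, fun n => ?_⟩
    · have := (H.h n).mapsInto_W (p + r)
      change MapsInto _ ((K.deg (n + 1)).W (p + r - r)) _ at this
      rwa [add_sub_cancel_right] at this
    · refine (congrArg Hom.val (H.comm n)).trans ?_
      rw [comp_val, sub_val]
      exact Category.id_comp _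
  · rintro ⟨h, hW, hF, hcomm⟩
    refine ⟨⟨fun n => ⟨h n, fun p => ?_, hF n⟩, fun n => hom_ext ?_⟩⟩
    · have := hW n (p - r)
      rwa [sub_add_cancel] at this
    · refine (hcomm n).trans ?_
      rw [comp_val, sub_val]
      exact (Category.id_comp _).symm

/-- The `(0,0)`-homotopies are the homotopies in the category of bifiltered objects. -/
lemma nonempty_rHomotopy_zero_iff {K L : BifilteredComplex A} (f g : K ⟶ L) :
    Nonempty (RHomotopy 0 f g) ↔ Nonempty (Homotopy f.hom g.hom) := by
  rw [nonempty_rHomotopy_iff]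
  constructor
  · rintro ⟨h, hW, hF, hcomm⟩
    let h' (n : ℤ) : K.deg (n + 1) ⟶ L.deg n :=
      ⟨h n, fun p => by have := hW n p; rwa [Nat.cast_zero, add_zero] at this, hF n⟩
    let H (i j : ℤ) (hij : (ComplexShape.up ℤ).Rel j i) : K.obj.X i ⟶ L.obj.X j :=
      eqToHom (congrArg K.obj.X hij.symm) ≫ h' j
    have hH (j : ℤ) : H (j + 1) j rfl = h' j := Category.id_comp _
    have : g.hom - f.hom = Homotopy.nullHomotopicMap' H := by
      ext n
      obtain ⟨n, rfl⟩ : ∃ k, n = k + 1 := ⟨n - 1, by lia⟩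
      rw [Homotopy.nullHomotopicMap'_f (c := ComplexShape.up ℤ) (k₂ := n) (k₀ := n + 1 + 1) rfl rfl,
        hH, hH, add_comm (_ ≫ _), HomologicalComplex.sub_f_apply, sub_val]
      exact (hcomm n).symm
    exact ⟨(Homotopy.equivSubZero.symm
      ((Homotopy.ofEq this).trans (Homotopy.nullHomotopy' H))).symm⟩
  · rintro ⟨H⟩
    refine ⟨fun n => (H.symm.hom (n + 1) n).val, fun n p => ?_,
      fun n => (H.symm.hom (n + 1) n).mapsInto_F, fun n => ?_⟩
    · rw [Nat.cast_zero, add_zero]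
      exact (H.symm.hom (n + 1) n).mapsInto_W p
    · have := congrArg Hom.val (H.symm.comm (n + 1))
      rw [dNext_eq (c := ComplexShape.up ℤ) _ (i := n + 1) (i' := n + 1 + 1) rfl,
        prevD_eq (c := ComplexShape.up ℤ) _ (j' := n) (j := n + 1) rfl] at this
      change (g.hom.f (n + 1)).val = _ + _ + (f.hom.f (n + 1)).val at this
      rw [eq_sub_iff_add_eq, add_comm (_ ≫ _)]
      exact this.symm

lemma homotopyEquiv_zero :
    homotopyEquiv (A := A) 0 = (HomologicalComplex.homotopyEquivalences (BifilteredObject A)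
      (ComplexShape.up ℤ)).inverseImage (CochainComplex.Plus.ι _) := by
  ext K L f
  constructor
  · rintro ⟨g, h₁, h₂⟩
    rw [nonempty_rHomotopy_zero_iff] at h₁ h₂
    exact ⟨⟨f.hom, g.hom, h₁.some, h₂.some⟩, rfl⟩
  · rintro ⟨e, he⟩
    obtain ⟨g, hg⟩ : ∃ g : L ⟶ K, g.hom = e.inv := ⟨ObjectProperty.homMk e.inv, rfl⟩
    refine ⟨g, ?_, ?_⟩
    · rw [nonempty_rHomotopy_zero_iff]
      refine ⟨(Homotopy.ofEq ?_).trans e.homotopyHomInvId⟩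
      rw [ObjectProperty.FullSubcategory.comp_hom, hg, he]
      rfl
    · rw [nonempty_rHomotopy_zero_iff]
      refine ⟨(Homotopy.ofEq ?_).trans e.homotopyInvHomId⟩
      rw [ObjectProperty.FullSubcategory.comp_hom, hg, he]
      rfl

lemma homotopyEquiv_zero_le_quasiIso_zero :
    homotopyEquiv (A := A) 0 ≤ quasiIso 0 := by
  rw [homotopyEquiv_zero]
  rintro K L f ⟨e, he⟩ p q
  have : f.hom = e.hom := he.symm
  rw [this]
  exact ((gr p q).mapHomotopyEquiv e).quasiIso_hom

/-- Homotopic morphisms become equal once homotopy equivalences are inverted: this is the cylinder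
argument. -/
lemma homotopyEquiv_zero_Q_map_eq {K L : BifilteredComplex A} {f g : K ⟶ L}
    (h : Nonempty (RHomotopy 0 f g)) :
    (homotopyEquiv (A := A) 0).Q.map f = (homotopyEquiv (A := A) 0).Q.map g := by
  have h' : (HomotopyCategory.Plus.quotient (BifilteredObject A)).map f =
      (HomotopyCategory.Plus.quotient _).map g := by
    ext
    exact HomotopyCategory.eq_of_homotopy _ _ ((nonempty_rHomotopy_zero_iff f g).1 h).some
  have : (HomotopyCategory.Plus.quotient (BifilteredObject A)).IsLocalization
      (homotopyEquiv (A := A) 0) := by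
    rw [homotopyEquiv_zero]
    infer_instance
  rwa [← areEqualizedByLocalization_iff _ (homotopyEquiv (A := A) 0),
    areEqualizedByLocalization_iff (HomotopyCategory.Plus.quotient _)]

lemma rHomotopy_zero_iff_quotient_map_eq {K L : BifilteredComplex A} (f g : K ⟶ L) :
    Nonempty (RHomotopy 0 f g) ↔
      (HomotopyCategory.quotient _ _).map f.hom = (HomotopyCategory.quotient _ _).map g.hom := by
  rw [nonempty_rHomotopy_zero_iff]
  exact ⟨fun ⟨h⟩ => HomotopyCategory.eq_of_homotopy _ _ h,
    fun h => ⟨HomotopyCategory.homotopyOfEq _ _ h⟩⟩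

end BifilteredComplex

/-! ### The right adjoint of the dual décalage -/

namespace BifilteredComplex

open BifilteredObject

variable {A : Type u} [Category.{v} A] [Abelian A]

lemma hom_ext_val {K L : BifilteredComplex A} {f g : K ⟶ L}
    (h : ∀ n, (comp f n).val = (comp g n).val) : f = g := by
  ext n
  exact h n

/-- A morphism of bifiltered complexes given by its components in `A`. -/
def mkHom {K L : BifilteredComplex A} (f : ∀ n, (K.deg n).X ⟶ (L.deg n).X)
    (hW : ∀ n p, MapsInto (f n) ((K.deg n).W p) ((L.deg n).W p))
    (hF : ∀ n q, MapsInto (f n) ((K.deg n).F q) ((L.deg n).F q))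
    (hf : ∀ n, f n ≫ (L.diff n (n + 1)).val = (K.diff n (n + 1)).val ≫ f (n + 1)) : K ⟶ L :=
  ObjectProperty.homMk
    { f := fun n => ⟨f n, hW n, hF n⟩
      comm' := by
        rintro i _ rfl
        exact hom_ext (hf i) }

lemma comm_val {K L : BifilteredComplex A} (f : K ⟶ L) (i j : ℤ) :
    (comp f i).val ≫ (L.diff i j).val = (K.diff i j).val ≫ (comp f j).val :=
  congrArg Hom.val (f.hom.comm i j)

/-- The functor `(K, W, F) ↦ (K, W', F)` with `W'_p K^n = W_{p+n} K^n`, which is right adjoint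
to the dual décalage. -/
def decStarRight : BifilteredComplex A ⥤ BifilteredComplex A where
  obj K := ⟨{
    X := fun n =>
      { X := (K.deg n).X
        W := fun p => (K.deg n).W (p + n)
        F := (K.deg n).F
        W_mono := fun _ _ h => (K.deg n).W_mono (by lia)
        F_anti := (K.deg n).F_anti
        W_bot := by
          obtain ⟨p, hp⟩ := (K.deg n).W_bot
          exact ⟨p - n, by rw [sub_add_cancel, hp]⟩
        W_top := by
          obtain ⟨p, hp⟩ := (K.deg n).W_top
          exact ⟨p - n, by rw [sub_add_cancel, hp]⟩
        F_bot := (K.deg n).F_bot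
        F_top := (K.deg n).F_top }
    d := fun i j =>
      { val := (K.diff i j).val
        mapsInto_W := fun p => by
          by_cases h : i + 1 = j
          · exact ((K.diff i j).mapsInto_W _).mono le_rfl ((K.deg j).W_mono (by lia))
          · rw [show K.diff i j = 0 from K.obj.shape i j h]
            exact mapsInto_zero _ _
        mapsInto_F := (K.diff i j).mapsInto_F }
    shape := fun i j hij => by
      have h : (K.diff i j).val = 0 := congrArg Hom.val (K.obj.shape i j hij)
      exact hom_ext h
    d_comp_d' := fun i j k _ _ => by
      have h : (K.diff i j).val ≫ (K.diff j k).val = 0 :=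
        congrArg Hom.val (K.obj.d_comp_d i j k)
      exact hom_ext h }, by
    obtain ⟨n, hn⟩ := K.property
    refine ⟨n, (CochainComplex.isStrictlyGE_iff _ n).2 fun i hi => ?_⟩
    rw [IsZero.iff_id_eq_zero]
    have h := (IsZero.iff_id_eq_zero _).1 (K.obj.isZero_of_isStrictlyGE n i hi)
    have h' : 𝟙 (K.deg i).X = 0 := congrArg Hom.val h
    exact hom_ext h'⟩
  map {K L} f := mkHom (fun n => (comp f n).val) (fun n p => (comp f n).mapsInto_W (p + n))
    (fun n => (comp f n).mapsInto_F) (fun n => comm_val f n (n + 1))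
  map_id _ := hom_ext_val fun _ => rfl
  map_comp _ _ := hom_ext_val fun _ => rfl

lemma W_le_decStarW (K : BifilteredComplex A) (n p : ℤ) :
    (K.deg n).W p ≤ decStarW K.obj n (p + n) := by
  refine le_sup_of_le_right ((K.deg n).W_mono (by lia))

/-- The unit of the adjunction between the dual décalage and its right adjoint. -/
noncomputable def decStarUnit (K : BifilteredComplex A) :
    K ⟶ decStarRight.obj (decStar.obj K) :=
  mkHom (fun n => 𝟙 (K.deg n).X) (fun n p => mapsInto_id (W_le_decStarW K n p))
    (fun _ _ => mapsInto_id le_rfl)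
    (fun _ => (Category.id_comp _).trans (Category.comp_id _).symm)

lemma decStarUnit_naturality {K L : BifilteredComplex A} (f : K ⟶ L) :
    f ≫ decStarUnit L = decStarUnit K ≫ decStarRight.map (decStar.map f) :=
  hom_ext_val fun _ => (Category.comp_id _).trans (Category.id_comp _).symm

lemma decStarW_decStarRight (J : BifilteredComplex A) (n p : ℤ) :
    decStarW (decStarRight.obj J).obj n p = (J.deg n).W p := by
  refine le_antisymm (sup_le ?_ ((J.deg n).W_mono (by lia))) ?_
  · refine (mapsInto_iff_imageOf_le (S := (J.deg (n - 1)).W (p - n + 1 + (n - 1)))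
      (f := (J.diff (n - 1) n).val)).1 ?_
    exact ((J.diff (n - 1) n).mapsInto_W _).mono le_rfl ((J.deg n).W_mono (by lia))
  · exact le_sup_of_le_right ((J.deg n).W_mono (by lia))

/-- The counit of the adjunction between the dual décalage and its right adjoint: it is
an isomorphism. -/
noncomputable def decStarCounitIso (J : BifilteredComplex A) :
    decStar.obj (decStarRight.obj J) ≅ J where
  hom := mkHom (fun n => 𝟙 (J.deg n).X)
    (fun n p => mapsInto_id (decStarW_decStarRight J n p).le) (fun _ _ => mapsInto_id le_rfl)
    (fun _ => (Category.id_comp _).trans (Category.comp_id _).symm)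
  inv := mkHom (fun n => 𝟙 (J.deg n).X)
    (fun n p => mapsInto_id (decStarW_decStarRight J n p).ge) (fun _ _ => mapsInto_id le_rfl)
    (fun _ => (Category.id_comp _).trans (Category.comp_id _).symm)
  hom_inv_id := hom_ext_val fun _ => Category.id_comp _
  inv_hom_id := hom_ext_val fun _ => Category.id_comp _

/-- Morphisms `Dec* K ⟶ J` extend along the unit. -/
lemma exists_decStar_map_eq {K J : BifilteredComplex A} (f : decStar.obj K ⟶ J) :
    ∃ g : K ⟶ decStarRight.obj J, decStar.map g = f ≫ (decStarCounitIso J).inv := by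
  refine ⟨decStarUnit K ≫ decStarRight.map f, hom_ext_val fun n => ?_⟩
  exact (Category.id_comp _).trans (Category.comp_id _).symm

/-! ### Injective complexes and the dual décalage -/

lemma injective_cokernel_ofLE {X : A} {S S' T T' : Subobject X} (hS : S = S') (hT : T = T')
    (h : S ≤ T) (h' : S' ≤ T') (hI : Injective (cokernel (Subobject.ofLE S T h))) :
    Injective (cokernel (Subobject.ofLE S' T' h')) := by
  subst hS hT
  exact hI

lemma isInjective_iff {r : ℕ} {I : BifilteredComplex A} :
    isInjective r I ↔
      (∀ n p, MapsInto (I.diff n (n + 1)).val ((I.deg n).W p) ((I.deg (n + 1)).W (p - r))) ∧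
      ∀ p q n, Injective ((gr p q).obj (I.deg n)) := by
  constructor
  · intro h
    refine ⟨fun n p => ?_, fun p q n => (h p q n).2⟩
    -- The condition for `W` alone is the case `F^q = ⊤`.
    obtain ⟨q, hq⟩ := (I.deg n).F_top
    exact (h p q n).1.mono (le_inf le_rfl (le_top.trans hq.ge)) _root_.inf_le_left
  · rintro ⟨h₁, h₂⟩ p q n
    exact ⟨(h₁ n p).inf ((I.diff n (n + 1)).mapsInto_F q), h₂ p q n⟩

section

variable {r : ℕ} {M : BifilteredComplex A} (hM : isInjective (r + 1) M)

include hM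

lemma isInjective.mapsInto_diff (i j p : ℤ) (hij : i + 1 = j) :
    MapsInto (M.diff i j).val ((M.deg i).W p) ((M.deg j).W (p - r - 1)) := by
  subst hij
  exact ((isInjective_iff.1 hM).1 i p).mono le_rfl ((M.deg (i + 1)).W_mono (by lia))

lemma isInjective.decStarW_eq (n p : ℤ) : decStarW M.obj n p = (M.deg n).W (p - n) := by
  refine sup_eq_right.2 ?_
  rw [← mapsInto_iff_imageOf_le]
  exact (hM.mapsInto_diff (n - 1) n _ (by lia)).mono le_rfl ((M.deg n).W_mono (by lia))

lemma isInjective.decStar : isInjective r (decStar.obj M) := by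
  rw [isInjective_iff]
  constructor
  · intro n p
    change MapsInto (M.diff n (n + 1)).val (decStarW M.obj n p) (decStarW M.obj (n + 1) (p - r))
    rw [hM.decStarW_eq, hM.decStarW_eq]
    exact (hM.mapsInto_diff n (n + 1) _ rfl).mono le_rfl ((M.deg (n + 1)).W_mono (by lia))
  · intro p q n
    refine injective_cokernel_ofLE ?_ ?_ ((M.deg n).WFlow_le (p - n) q) _
      ((isInjective_iff.1 hM).2 (p - n) q n)
    · change (M.deg n).W (p - n - 1) ⊓ (M.deg n).F q ⊔ (M.deg n).W (p - n) ⊓ (M.deg n).F (q + 1) =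
        decStarW M.obj n (p - 1) ⊓ (M.deg n).F q ⊔ decStarW M.obj n p ⊓ (M.deg n).F (q + 1)
      rw [hM.decStarW_eq, hM.decStarW_eq, sub_right_comm]
    · change (M.deg n).W (p - n) ⊓ (M.deg n).F q = decStarW M.obj n p ⊓ (M.deg n).F q
      rw [hM.decStarW_eq]

lemma isInjective.isIso_decStarUnit : IsIso (decStarUnit M) := by
  refine ⟨mkHom (fun n => 𝟙 (M.deg n).X) (fun n p => mapsInto_id ?_)
    (fun _ _ => mapsInto_id le_rfl) (fun _ => (Category.id_comp _).trans (Category.comp_id _).symm),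
    hom_ext_val fun _ => Category.id_comp _, hom_ext_val fun _ => Category.id_comp _⟩
  change decStarW M.obj n (p + n) ≤ _
  rw [hM.decStarW_eq, add_sub_cancel_right]

/-- The dual décalage is fully faithful on morphisms to `(r+1,0)`-injective complexes. -/
lemma isInjective.bijective_decStar_map (X : BifilteredComplex A) :
    Function.Bijective (fun f : X ⟶ M => BifilteredComplex.decStar.map f) := by
  constructor
  · intro f g h
    have h' : BifilteredComplex.decStar.map f = BifilteredComplex.decStar.map g := h
    exact hom_ext_val fun n => congrArg (fun φ :
      BifilteredComplex.decStar.obj X ⟶ BifilteredComplex.decStar.obj M => (comp φ n).val) h'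
  · intro g
    have := hM.isIso_decStarUnit
    refine ⟨decStarUnit X ≫ decStarRight.map g ≫ inv (decStarUnit M), hom_ext_val fun n => ?_⟩
    have h : decStarUnit X ≫ decStarRight.map g =
        (decStarUnit X ≫ decStarRight.map g ≫ inv (decStarUnit M)) ≫ decStarUnit M := by simp
    have h' := congrArg (fun φ => (comp φ n).val) h
    exact ((Category.id_comp _).symm.trans (h'.trans (Category.comp_id _))).symm

end

lemma isInjective_decStarRight {r : ℕ} {J : BifilteredComplex A} (hJ : isInjective r J) :
    isInjective (r + 1) (decStarRight.obj J) := by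
  rw [isInjective_iff] at hJ ⊢
  constructor
  · intro n p
    exact (hJ.1 n (p + n)).mono le_rfl ((J.deg (n + 1)).W_mono (by lia))
  · intro p q n
    refine injective_cokernel_ofLE ?_ rfl ((J.deg n).WFlow_le (p + n) q) _ (hJ.2 (p + n) q n)
    change (J.deg n).W (p + n - 1) ⊓ (J.deg n).F q ⊔ (J.deg n).W (p + n) ⊓ (J.deg n).F (q + 1) =
        (J.deg n).W (p - 1 + n) ⊓ (J.deg n).F q ⊔ (J.deg n).W (p + n) ⊓ (J.deg n).F (q + 1)
    rw [sub_add_eq_add_sub]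

/-! ### Homotopies and the dual décalage -/

/-- The dual décalage sends `(r+1,0)`-homotopies to `(r,0)`-homotopies: on the boundaries
`d(W)` the homotopy `h` is controlled by `h d = g - f - d h`. -/
lemma rHomotopy_decStar {r : ℕ} {K L : BifilteredComplex A} {f g : K ⟶ L}
    (H : Nonempty (RHomotopy (r + 1) f g)) :
    Nonempty (RHomotopy r (decStar.map f) (decStar.map g)) := by
  rw [nonempty_rHomotopy_iff] at H ⊢
  obtain ⟨h, hW, hF, hcomm⟩ := H
  refine ⟨h, fun n p => ?_, hF, hcomm⟩
  change MapsInto (h n) (decStarW K.obj (n + 1) p) (decStarW L.obj n (p + r))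
  refine MapsInto.sup ?_ ?_
  · obtain ⟨n, rfl⟩ : ∃ k, n = k + 1 := ⟨n - 1, by lia⟩
    rw [mapsInto_imageOf_iff, show (n + 1 + 1 - 1 : ℤ) = n + 1 by lia]
    have h₁ : (K.diff (n + 1) (n + 1 + 1)).val ≫ h (n + 1) =
        (comp g (n + 1)).val + -(comp f (n + 1)).val + -(h n ≫ (L.diff n (n + 1)).val) := by
      rw [← sub_eq_add_neg, ← sub_eq_add_neg, ← hcomm n, add_sub_cancel_left]
    refine (congrArg (fun z => MapsInto z _ _) h₁).mpr ?_
    have h₂ (φ : K ⟶ L) : MapsInto (comp φ (n + 1)).val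
        ((K.deg (n + 1)).W (p - (n + 1 + 1) + 1)) (decStarW L.obj (n + 1) (p + r)) :=
      ((comp φ (n + 1)).mapsInto_W _).mono le_rfl
        (le_sup_of_le_right ((L.deg (n + 1)).W_mono (by lia)))
    refine ((h₂ g).add (h₂ f).neg).add (MapsInto.neg ?_)
    have h₃ (m : ℤ) (hm : m = n) : imageOf (L.diff n (n + 1)).val
        ((L.deg n).W (p + r - (n + 1) + 1)) =
        imageOf (L.diff m (n + 1)).val ((L.deg m).W (p + r - (n + 1) + 1)) := by
      subst hm; rfl
    refine (hW n _).comp ((mapsInto_imageOf _ _).mono ((L.deg n).W_mono ?_)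
      (le_sup_of_le_left (h₃ _ (by lia)).le))
    push_cast
    lia
  · refine (hW n _).mono le_rfl (le_sup_of_le_right ((L.deg n).W_mono ?_))
    push_cast
    lia

lemma rHomotopy_decStar_iff {r : ℕ} {K M : BifilteredComplex A} (hM : isInjective (r + 1) M)
    (f g : K ⟶ M) : Nonempty (RHomotopy (r + 1) f g) ↔
      Nonempty (RHomotopy r (decStar.map f) (decStar.map g)) := by
  refine ⟨rHomotopy_decStar, fun H => ?_⟩
  rw [nonempty_rHomotopy_iff] at H ⊢
  obtain ⟨h, hW, hF, hcomm⟩ := H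
  refine ⟨h, fun n p => ?_, hF, hcomm⟩
  have := hW n (p + (n + 1))
  change MapsInto (h n) (decStarW K.obj (n + 1) _) (decStarW M.obj n _) at this
  rw [hM.decStarW_eq] at this
  refine this.mono (W_le_decStarW K (n + 1) p) ((M.deg n).W_mono ?_)
  push_cast
  lia

lemma rHomotopy_decStarRight {r : ℕ} {K L : BifilteredComplex A} {f g : K ⟶ L}
    (H : Nonempty (RHomotopy r f g)) :
    Nonempty (RHomotopy (r + 1) (decStarRight.map f) (decStarRight.map g)) := by
  rw [nonempty_rHomotopy_iff] at H ⊢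
  obtain ⟨h, hW, hF, hcomm⟩ := H
  refine ⟨h, fun n p => (hW n (p + (n + 1))).mono le_rfl ((L.deg n).W_mono ?_), hF, hcomm⟩
  push_cast
  lia

lemma homotopyEquiv_le_inverseImage_decStarRight (r : ℕ) :
    homotopyEquiv (A := A) r ≤ (homotopyEquiv (r + 1)).inverseImage decStarRight := by
  rintro K L f ⟨g, h₁, h₂⟩
  refine ⟨decStarRight.map g, ?_, ?_⟩
  · exact (decStarRight.map_id K) ▸ (decStarRight.map_comp f g) ▸ rHomotopy_decStarRight h₁
  · exact (decStarRight.map_id L) ▸ (decStarRight.map_comp g f) ▸ rHomotopy_decStarRight h₂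

lemma homotopyEquiv_succ_le_inverseImage_decStar (r : ℕ) :
    homotopyEquiv (A := A) (r + 1) ≤ (homotopyEquiv r).inverseImage decStar := by
  rintro K L f ⟨g, h₁, h₂⟩
  refine ⟨decStar.map g, ?_, ?_⟩
  · exact (decStar.map_id K) ▸ (decStar.map_comp f g) ▸ rHomotopy_decStar h₁
  · exact (decStar.map_id L) ▸ (decStar.map_comp g f) ▸ rHomotopy_decStar h₂

end BifilteredComplex

/-! ### Morphisms in a localization computed by an equivalence relation -/

namespace CartanEilenberg

variable {C : Type u} [Category.{v} C]

/-- Equivalence relations on the sets `X ⟶ M`, for a fixed object `M` and varying `X`, which are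
stable under precomposition and for which precomposition with a morphism of `W` induces
a bijection on equivalence classes. -/
structure IsLocalSetoid (W : MorphismProperty C) (M : C) (R : ∀ X : C, Setoid (X ⟶ M)) : Prop where
  precomp {X Y : C} (u : X ⟶ Y) {f g : Y ⟶ M} : R Y f g → R X (u ≫ f) (u ≫ g)
  injective {X Y : C} (w : X ⟶ Y) (hw : W w) {f g : Y ⟶ M} : R X (w ≫ f) (w ≫ g) → R Y f g
  surjective {X Y : C} (w : X ⟶ Y) (hw : W w) (f : X ⟶ M) : ∃ g : Y ⟶ M, R X (w ≫ g) f

namespace IsLocalSetoid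

variable {W : MorphismProperty C} {M : C} {R : ∀ X : C, Setoid (X ⟶ M)} (h : IsLocalSetoid W M R)

include h

lemma mono {S : MorphismProperty C} (hS : S ≤ W) : IsLocalSetoid S M R where
  precomp := h.precomp
  injective w hw := h.injective w (hS w hw)
  surjective w hw := h.surjective w (hS w hw)

/-- Morphisms to `M` which become equal in the localization are equivalent: the presheaf
of equivalence classes inverts `W`, hence factors through the localization. -/
lemma rel_of_Q_map_eq {X : C} {f g : X ⟶ M} (hfg : W.Q.map f = W.Q.map g) : R X f g := by
  let G : Cᵒᵖ ⥤ Type v :=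
    { obj X := Quotient (R X.unop)
      map u := TypeCat.ofHom (Quotient.map (u.unop ≫ ·) fun _ _ => h.precomp u.unop)
      map_id X := by
        ext x
        obtain ⟨x, rfl⟩ := Quotient.exists_rep x
        simp
      map_comp u v := by
        ext x
        obtain ⟨x, rfl⟩ := Quotient.exists_rep x
        simp }
  have hG : W.IsInvertedBy G.rightOp := by
    intro X Y w hw
    suffices IsIso (G.map w.op) from inferInstanceAs (IsIso (G.map w.op).op)
    rw [isIso_iff_bijective]
    constructor
    · intro x y hxy
      obtain ⟨x, rfl⟩ := Quotient.exists_rep x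
      obtain ⟨y, rfl⟩ := Quotient.exists_rep y
      exact Quotient.sound (h.injective w hw (Quotient.exact hxy))
    · intro x
      obtain ⟨x, rfl⟩ := Quotient.exists_rep x
      obtain ⟨g, hg⟩ := h.surjective w hw x
      exact ⟨Quotient.mk _ g, Quotient.sound hg⟩
  have h₁ := ((areEqualizedByLocalization_iff W.Q W f g).2 hfg).map_eq_of_isInvertedBy _ hG
  have h₂ : G.map f.op = G.map g.op := congrArg Quiver.Hom.unop h₁
  replace h₂ : G.map f.op (Quotient.mk _ (𝟙 M)) = G.map g.op (Quotient.mk _ (𝟙 M)) := by rw [h₂]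
  have h₃ : R X (f ≫ 𝟙 M) (g ≫ 𝟙 M) := Quotient.exact h₂
  rwa [Category.comp_id, Category.comp_id] at h₃

/-- If equivalent morphisms become equal in the localization, then every morphism to `M` in
the localization is represented by a morphism to `M`: fractions can be simplified. -/
lemma Q_map_surjective (hR : ∀ {X : C} {f g : X ⟶ M}, R X f g → W.Q.map f = W.Q.map g) (X : C) :
    Function.Surjective (fun f : X ⟶ M => W.Q.map f) := by
  -- Precomposition with a morphism of the localization preserves represented morphisms to `M`:
  -- this is checked on the morphisms of `C` and on the formal inverses.
  let P : MorphismProperty W.Localization := fun Z Z' φ =>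
    ∀ f : (Localization.Construction.objEquiv W).symm Z' ⟶ M,
      ∃ g : (Localization.Construction.objEquiv W).symm Z ⟶ M, φ ≫ W.Q.map f = W.Q.map g
  have : P.IsStableUnderComposition := ⟨fun φ ψ hφ hψ f => by
    obtain ⟨g, hg⟩ := hψ f
    obtain ⟨g', hg'⟩ := hφ g
    exact ⟨g', (Category.assoc _ _ _).trans ((φ ≫= hg).trans hg')⟩⟩
  have hP : P = ⊤ := by
    refine Localization.Construction.morphismProperty_eq_top P
      (fun X Y u f => ⟨u ≫ f, (W.Q.map_comp u f).symm⟩) (fun X Y w hw f => ?_)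
    obtain ⟨g, hg⟩ := h.surjective w hw f
    refine ⟨g, (Localization.Construction.wInv w hw ≫= (hR hg).symm).trans ?_⟩
    rw [W.Q.map_comp]
    exact (Localization.Construction.wIso w hw).inv_hom_id_assoc _
  intro φ
  have hφ : P φ := by
    rw [hP]
    trivial
  obtain ⟨g, hg⟩ := hφ (𝟙 M)
  refine ⟨g, hg.symm.trans ?_⟩
  refine (φ ≫= W.Q.map_id M).trans (Category.comp_id _)

end IsLocalSetoid

end CartanEilenberg

/-! ### Injective models in the category of bifiltered complexes -/

namespace BifilteredComplex

open BifilteredObject CartanEilenberg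

variable {A : Type u} [Category.{v} A] [Abelian A]

instance quasiIso_respectsIso (r : ℕ) : (quasiIso (A := A) r).RespectsIso := by
  induction r with
  | zero =>
    refine MorphismProperty.RespectsIso.mk _ (fun e f hf p q => ?_) (fun e f hf p q => ?_)
    all_goals
      have := hf p q
      have : IsIso e.hom.hom := inferInstanceAs (IsIso ((CochainComplex.Plus.ι _).map e.hom))
      rw [ObjectProperty.FullSubcategory.comp_hom, Functor.map_comp]
      infer_instance
  | succ r ih => exact inferInstanceAs (((quasiIso r).inverseImage decStar).RespectsIso)

/-- Homotopy equivalences are weak equivalences. -/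
lemma homotopyEquiv_le_quasiIso (r : ℕ) : homotopyEquiv (A := A) r ≤ quasiIso r := by
  induction r with
  | zero => exact homotopyEquiv_zero_le_quasiIso_zero
  | succ r ih => exact fun K L f hf => ih _ (homotopyEquiv_succ_le_inverseImage_decStar r f hf)

/-- Homotopic morphisms to an injective complex become equal once the homotopy equivalences
are inverted. -/
lemma homotopyEquiv_Q_map_eq {r : ℕ} {X M : BifilteredComplex A} (hM : isInjective r M)
    {f g : X ⟶ M} (h : Nonempty (RHomotopy r f g)) :
    (homotopyEquiv (A := A) r).Q.map f = (homotopyEquiv (A := A) r).Q.map g := by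
  induction r generalizing X M with
  | zero => exact homotopyEquiv_zero_Q_map_eq h
  | succ r ih =>
    -- Apply the case of `r` to the décalages, and return through the right adjoint of the
    -- décalage, using that the unit is an isomorphism at `M`.
    have h₁ := ih hM.decStar (rHomotopy_decStar h)
    have hT : (homotopyEquiv (A := A) r).IsInvertedBy
        (decStarRight ⋙ (homotopyEquiv (A := A) (r + 1)).Q) := fun K L w hw =>
      (homotopyEquiv (A := A) (r + 1)).Q_inverts _
        (homotopyEquiv_le_inverseImage_decStarRight r w hw)
    have h₂ := ((areEqualizedByLocalization_iff _ _ _ _).2 h₁).map_eq_of_isInvertedBy _ hT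
    have := hM.isIso_decStarUnit
    rw [← cancel_mono ((homotopyEquiv (A := A) (r + 1)).Q.map (decStarUnit M)),
      ← Functor.map_comp, ← Functor.map_comp, decStarUnit_naturality, decStarUnit_naturality,
      Functor.map_comp, Functor.map_comp]
    exact _ ≫= h₂

/-- Homotopy is an equivalence relation on morphisms to an injective complex. -/
lemma rHomotopy_equivalence {r : ℕ} {M : BifilteredComplex A} (hM : isInjective r M)
    (X : BifilteredComplex A) : Equivalence (fun f g : X ⟶ M => Nonempty (RHomotopy r f g)) := by
  induction r generalizing X M with
  | zero =>
    simp only [rHomotopy_zero_iff_quotient_map_eq]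
    exact eq_equivalence.comap _
  | succ r ih =>
    simp only [rHomotopy_decStar_iff hM]
    exact (ih hM.decStar (decStar.obj X)).comap _

/-- The homotopy relation on morphisms to an injective complex. -/
def homotopySetoid {r : ℕ} {M : BifilteredComplex A} (hM : isInjective r M)
    (X : BifilteredComplex A) : Setoid (X ⟶ M) :=
  ⟨_, rHomotopy_equivalence hM X⟩

/-- Homotopy classes of morphisms to an injective complex are invariant under weak
equivalences. -/
lemma isLocalSetoid_homotopySetoid {r : ℕ} {M : BifilteredComplex A} (hM : isInjective r M) :
    IsLocalSetoid (quasiIso r) M (homotopySetoid hM) := by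
  induction r generalizing M with
  | zero =>
    obtain ⟨d, _⟩ := M.property
    have key {X Y : BifilteredComplex A} (w : X ⟶ Y) (hw : quasiIso 0 w) :=
      bijective_precomp_homotopyCategory w.hom hw d (isInjective_iff.1 hM).2
    have rel {X : BifilteredComplex A} (f g : X ⟶ M) : homotopySetoid hM X f g ↔
        (HomotopyCategory.quotient _ _).map f.hom = (HomotopyCategory.quotient _ _).map g.hom :=
      rHomotopy_zero_iff_quotient_map_eq f g
    refine ⟨fun u f g h => ?_, fun w hw f g h => ?_, fun w hw f => ?_⟩
    · rw [rel] at h ⊢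
      simp only [ObjectProperty.FullSubcategory.comp_hom, Functor.map_comp, h]
    · rw [rel] at h ⊢
      simp only [ObjectProperty.FullSubcategory.comp_hom, Functor.map_comp] at h
      exact (key w hw).1 h
    · obtain ⟨g, hg⟩ := (key w hw).2 ((HomotopyCategory.quotient _ _).map f.hom)
      obtain ⟨g, rfl⟩ := (HomotopyCategory.quotient _ _).map_surjective g
      refine ⟨ObjectProperty.homMk g, ?_⟩
      rw [rel, ← hg]
      exact Functor.map_comp _ _ _
  | succ r ih =>
    have hD := ih hM.decStar
    have rel {X : BifilteredComplex A} (f g : X ⟶ M) : homotopySetoid hM X f g ↔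
        homotopySetoid hM.decStar (decStar.obj X) (decStar.map f) (decStar.map g) :=
      rHomotopy_decStar_iff hM f g
    refine ⟨fun u f g h => ?_, fun w hw f g h => ?_, fun w hw f => ?_⟩
    · rw [rel] at h ⊢
      exact hD.precomp (decStar.map u) h
    · rw [rel] at h ⊢
      exact hD.injective (decStar.map w) hw h
    · obtain ⟨g, hg⟩ := hD.surjective (decStar.map w) hw (decStar.map f)
      obtain ⟨g, rfl⟩ := (hM.bijective_decStar_map _).2 g
      exact ⟨g, (rel _ _).2 hg⟩

/-- Every bifiltered complex is weakly equivalent to an injective complex. -/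
lemma exists_isInjective_quasiIso [EnoughInjectives A] (r : ℕ) (X : BifilteredComplex A) :
    ∃ (M : BifilteredComplex A) (f : X ⟶ M), isInjective r M ∧ quasiIso r f := by
  induction r generalizing X with
  | zero =>
    obtain ⟨N, _⟩ := X.property
    obtain ⟨I, f, hI, hI', hf⟩ := exists_injective_resolution X.obj N
    refine ⟨⟨I, N, hI⟩, ObjectProperty.homMk f, isInjective_iff.2 ⟨fun n p => ?_, hI'⟩, hf⟩
    rw [Nat.cast_zero, sub_zero]
    exact (I.d n (n + 1)).mapsInto_W p
  | succ r ih =>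
    obtain ⟨J, f, hJ, hf⟩ := ih (decStar.obj X)
    obtain ⟨g, hg⟩ := exists_decStar_map_eq f
    refine ⟨_, g, isInjective_decStarRight hJ, ?_⟩
    change quasiIso r (decStar.map g)
    rw [hg]
    exact MorphismProperty.RespectsIso.postcomp _ _ _ hf

section

variable {r : ℕ} {M : BifilteredComplex A} (hM : isInjective r M)

include hM

lemma homotopyEquiv_Q_map_eq_iff {X : BifilteredComplex A} (f g : X ⟶ M) :
    (homotopyEquiv (A := A) r).Q.map f = (homotopyEquiv (A := A) r).Q.map g ↔
      homotopySetoid hM X f g :=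
  ⟨((isLocalSetoid_homotopySetoid hM).mono (homotopyEquiv_le_quasiIso r)).rel_of_Q_map_eq,
    homotopyEquiv_Q_map_eq hM⟩

lemma homotopyEquiv_Q_map_surjective (X : BifilteredComplex A) :
    Function.Surjective (fun f : X ⟶ M => (homotopyEquiv (A := A) r).Q.map f) :=
  ((isLocalSetoid_homotopySetoid hM).mono (homotopyEquiv_le_quasiIso r)).Q_map_surjective
    (homotopyEquiv_Q_map_eq hM) X

lemma quasiIso_Q_map_eq {X : BifilteredComplex A} {f g : X ⟶ M} (h : homotopySetoid hM X f g) :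
    (quasiIso (A := A) r).Q.map f = (quasiIso (A := A) r).Q.map g :=
  ((areEqualizedByLocalization_iff (homotopyEquiv (A := A) r).Q _ _ _).2
    (homotopyEquiv_Q_map_eq hM h)).map_eq_of_isInvertedBy _
    fun _ _ w hw => (quasiIso r).Q_inverts w (homotopyEquiv_le_quasiIso r w hw)

/-- Morphisms to an injective complex in the localization by homotopy equivalences are homotopy
classes, and these are invariant under weak equivalences. -/
lemma isFibrant_of_isInjective : IsFibrant (homotopyEquiv r) (quasiIso r) M := by
  have hloc := isLocalSetoid_homotopySetoid hM
  intro X Y w hw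
  constructor
  · intro g₁ g₂ h
    obtain ⟨g₁, rfl⟩ := homotopyEquiv_Q_map_surjective hM Y g₁
    obtain ⟨g₂, rfl⟩ := homotopyEquiv_Q_map_surjective hM Y g₂
    simp only [← Functor.map_comp] at h
    rw [homotopyEquiv_Q_map_eq_iff hM] at h
    exact (homotopyEquiv_Q_map_eq_iff hM _ _).2 (hloc.injective w hw h)
  · intro f
    obtain ⟨f, rfl⟩ := homotopyEquiv_Q_map_surjective hM X f
    obtain ⟨g, hg⟩ := hloc.surjective w hw f
    refine ⟨(homotopyEquiv (A := A) r).Q.map g, ?_⟩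
    simp only [← Functor.map_comp]
    exact (homotopyEquiv_Q_map_eq_iff hM _ _).2 hg

end

/-- The injective complexes are fibrant models. -/
lemma isRightCartanEilenberg [EnoughInjectives A] (r : ℕ) :
    IsRightCartanEilenberg (homotopyEquiv (A := A) r) (quasiIso r) (isInjective r) where
  inverts _ _ w hw := (quasiIso r).Q_inverts w (homotopyEquiv_le_quasiIso r w hw)
  fibrant _ hM := isFibrant_of_isInjective hM
  exists_model X := by
    obtain ⟨M, f, hM, hf⟩ := exists_isInjective_quasiIso r X
    refine ⟨M, hM, (homotopyEquiv r).Q.map f, ?_⟩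
    exact (NatIso.isIso_map_iff (eqToIso (Localization.Construction.fac (quasiIso r).Q
      fun _ _ w hw => (quasiIso r).Q_inverts w (homotopyEquiv_le_quasiIso r w hw))) f).2
      ((quasiIso r).Q_inverts f hf)

/-- The functor from injective complexes modulo homotopy to the derived category. -/
noncomputable def injectiveHomotopyFunctor (A : Type u) [Category.{v} A] [Abelian A] (r : ℕ) :
    InjectiveHomotopyCategory A r ⥤ DerivedCat A r :=
  CategoryTheory.Quotient.lift _ ((isInjective (A := A) r).ι ⋙ (quasiIso r).Q)
    fun _ M _ _ h => quasiIso_Q_map_eq M.property h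

instance (r : ℕ) : (injectiveHomotopyFunctor A r).Full where
  map_surjective := by
    rintro ⟨X⟩ ⟨M⟩ φ
    obtain ⟨f, hf⟩ := (isLocalSetoid_homotopySetoid M.property).Q_map_surjective
      (quasiIso_Q_map_eq M.property) X.obj φ
    exact ⟨(CategoryTheory.Quotient.functor _).map (ObjectProperty.homMk f), hf⟩

instance (r : ℕ) : (injectiveHomotopyFunctor A r).Faithful where
  map_injective := by
    rintro ⟨X⟩ ⟨M⟩ φ ψ h
    obtain ⟨f, rfl⟩ := (CategoryTheory.Quotient.functor _).map_surjective φ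
    obtain ⟨g, rfl⟩ := (CategoryTheory.Quotient.functor _).map_surjective ψ
    exact CategoryTheory.Quotient.sound _
      ((isLocalSetoid_homotopySetoid M.property).rel_of_Q_map_eq h)

instance [EnoughInjectives A] (r : ℕ) : (injectiveHomotopyFunctor A r).EssSurj where
  mem_essImage Y := by
    obtain ⟨X, rfl⟩ := (Localization.Construction.objEquiv (quasiIso (A := A) r)).surjective Y
    obtain ⟨M, f, hM, hf⟩ := exists_isInjective_quasiIso r X
    have := (quasiIso r).Q_inverts f hf
    exact ⟨(CategoryTheory.Quotient.functor _).obj ⟨M, hM⟩, ⟨(asIso ((quasiIso r).Q.map f)).symm⟩⟩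

end BifilteredComplex

theorem mainTheorem12 (A : Type u) [Category.{v} A] [Abelian A] [EnoughInjectives A] (r : ℕ) :
    BifilteredComplex.homotopyEquiv (A := A) r ≤ BifilteredComplex.quasiIso r ∧
    CartanEilenberg.IsRightCartanEilenberg
      (BifilteredComplex.homotopyEquiv (A := A) r)
      (BifilteredComplex.quasiIso r)
      (BifilteredComplex.isInjective r) ∧
    ∃ Φ : BifilteredComplex.InjectiveHomotopyCategory A r ⥤ BifilteredComplex.DerivedCat A r,
      CategoryTheory.Quotient.functor (BifilteredComplex.injectiveHomotopyRel A r) ⋙ Φ =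
        (BifilteredComplex.isInjective (A := A) r).ι ⋙ (BifilteredComplex.quasiIso r).Q ∧
      Φ.IsEquivalence := by
  refine ⟨BifilteredComplex.homotopyEquiv_le_quasiIso r,
    BifilteredComplex.isRightCartanEilenberg r, BifilteredComplex.injectiveHomotopyFunctor A r,
    CategoryTheory.Quotient.lift_spec _ _ _, { }⟩
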